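/- Fix a radially symmetric $\varphi\in C_c^\infty(\mathbb{R}^3)$ with $0\le\varphi\le 1$, $\operatorname{supp}\varphi\subseteq\{|\xi|\le 2\}$ and $\varphi=1$ on $\{|\xi|<1\}$. For $N>0$ let $P_{\ge N}$ be the Fourier multiplier $\widehat{P_{\ge N}f}(\xi)=(1-\varphi(\xi/N))\,\hat f(\xi)$, where $\hat f(\xi)=\int e^{-ix\cdot\xi}f(x)\,dx$. For $0<s<\frac32$, $\dot H^s(\mathbb{R}^3)$ is the space of tempered distributions $f$ whose Fourier transform is a locally integrable function with $\|f\|_{\dot H^s}^2=\|(-\Delta)^{s/2}f\|_{L^2}^2=(2\pi)^{-3}\int|\xi|^{2s}|\hat f(\xi)|^2\,d\xi<\infty$; each of its elements is a function. **Proposition (reverse Sobolev inequality).** Let $0<s<\frac32$ and $\frac1q=\frac12-\frac s3$. There is a constant $c>0$, depending only on $s$ and $\varphi$, such that for every real-valued $f\in\dot H^s(\mathbb{R}^3)$ and every dyadic $N\in 2^{\mathbb{Z}}$ there exist $x\in\mathbb{R}^3$ and $0<r\le\frac2N$ with $$\left(\frac1{r^{2s}}\int_{B(x,r)}f(y)^2\,dy\right)^{1/2}\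 \ge\ c\,\|P_{\ge N}f\|_{L^q(\mathbb{R}^3)}^{\left(\frac3{2s}\right)^2}\,\|f\|_{\dot H^s}^{1-\left(\frac3{2s}\right)^2}$$ (for $f=0$ the right-hand side is read as $0$). Moreover, $c$ can be chosen uniformly for $s$ in any compact subinterval $[s_0,s_1]$ of $(0,\frac32)$. -/

import Mathlib

open MeasureTheory
open scoped ENNReal FourierTransform SchwartzMap

namespace ReverseSobolev

/-- Three-dimensional Euclidean space. -/
abbrev R3 : Type := EuclideanSpace ℝ (Fin 3)

/-- The tempered distribution `T` is (given by) the locally integrable function `g`: the two agree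
on all smooth compactly supported test functions. -/
def IsFunction (T : 𝓢'(R3, ℂ)) (g : R3 → ℂ) : Prop :=
  LocallyIntegrable g volume ∧
    ∀ u : 𝓢(R3, ℂ), HasCompactSupport u → T u = ∫ y, u y * g y

/-- The `L^q` norm of a tempered distribution, infinite if it is not a function in `L^q`.
(The representing function is unique up to a null set, so the infimum is over one value.) -/
noncomputable def lqNorm (q : ℝ) (T : 𝓢'(R3, ℂ)) : ℝ≥0∞ :=
  ⨅ (g : R3 → ℂ) (_ : IsFunction T g), eLpNorm g (ENNReal.ofReal q) volume

/-- The homogeneous Sobolev norm `(∫ |2πξ|^{2s} |f̂(ξ)|² dξ)^{1/2}` of a tempered distribution `f`,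
infinite if the Fourier transform of `f` is not a locally integrable function. Mathlib's Fourier
transform has the kernel `exp (-2πi x·ξ)`, so the frequency is `ω = 2πξ`; with this normalization
the norm is the `L²` norm of `(-Δ)^{s/2} f`. -/
noncomputable def homSobolevNorm (s : ℝ) (T : 𝓢'(R3, ℂ)) : ℝ≥0∞ :=
  ⨅ (g : R3 → ℂ) (_ : IsFunction (𝓕 T) g),
    (∫⁻ ξ, ENNReal.ofReal ((2 * Real.pi * ‖ξ‖) ^ (2 * s)) * ‖g ξ‖ₑ ^ 2) ^ (1 / 2 : ℝ)

/-- `T` belongs to the homogeneous Sobolev space of order `s`: its Fourier transform is a locally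
integrable function, and its homogeneous Sobolev norm is finite. -/
def MemHomSobolev (s : ℝ) (T : 𝓢'(R3, ℂ)) : Prop := homSobolevNorm s T < ⊤

/-- The bump functions from which Littlewood-Paley projections are built. -/
structure IsLittlewoodPaleyBump (φ : R3 → ℝ) : Prop where
  contDiff : ContDiff ℝ (⊤ : ℕ∞) φ
  radial : ∀ ξ η : R3, ‖ξ‖ = ‖η‖ → φ ξ = φ η
  nonneg : ∀ ξ, 0 ≤ φ ξ
  le_one : ∀ ξ, φ ξ ≤ 1
  tsupport_subset : tsupport φ ⊆ Metric.closedBall 0 2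
  eq_one : ∀ ξ ∈ Metric.ball (0 : R3) 1, φ ξ = 1

/-- The Littlewood-Paley projection to frequencies at least `N`: the Fourier multiplier with symbol
`1 - φ (ω / N)`, in the frequency variable `ω = 2πξ`. -/
noncomputable def projGE (φ : R3 → ℝ) (N : ℝ) (T : 𝓢'(R3, ℂ)) : 𝓢'(R3, ℂ) :=
  TemperedDistribution.fourierMultiplierCLM ℂ
    (fun ξ : R3 => ((1 - φ ((2 * Real.pi / N) • ξ) : ℝ) : ℂ)) T

end ReverseSobolev

/-! Write `ω = 2πξ`, `g` for the Fourier transform of `f`, and `θ = 3 / (2s) > 1`. The engine is one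
real-interpolation estimate. Suppose that for every `M ≥ N` the low-frequency part `P_{<M} f` is
bounded pointwise by `b M^(3/2-s)`. To measure `{|P_{≥N} f| > t}`, choose `M` with `4 b M^(3/2-s) =
t`. Since `P_{≥N} f - P_{≥M} f = P_{<M} f - P_{<N} f` is at most `t/2`, Chebyshev and Plancherel
bound the measure by `4 t⁻² ∫_{|ω| ≥ M} |g|²`; for small `t` take `M = N`. Integrating against
`t^(q-1)` gives `‖P_{≥N} f‖_q^θ ≲ b ‖f‖_{Ḣˢ}^(θ-1)` (`lqNorm_projGE_le`, `lqNorm_projGE_rpow_le`).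

Two values of `b` are available. Cauchy-Schwarz on the frequency side gives `b ≲ ‖f‖_{Ḣˢ}`, hence
the Sobolev inequality `exists_lqNorm_projGE_le_homSobolevNorm`. If all the local norms at radii `r
≤ 2/N` are at most `A`, the decay of the convolution kernel at scale `1/M` gives `b ≲ A`, hence
`exists_lqNorm_projGE_le_local`.

If the theorem failed, the second estimate would hold with `A = c ‖P_{≥N} f‖_q^(θ²) ‖f‖^(1-θ²)`. By
Sobolev the ratio of the two norms is bounded, so the exponent `θ²` may be lowered to `θ` at the
cost of a constant, and a small `c` gives a contradiction. -/

namespace ReverseSobolev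
open Filter Topology

/-! ### Approximation by compactly supported Schwartz functions. -/

section Density
variable {E : Type*} [NormedAddCommGroup E] [NormedSpace ℝ E]

/-- The derivatives vanish where `‖a • x‖ < 1`. Elsewhere `1 ≤ a ‖x‖`, so a factor `a` is gained for
one more power of the weight. -/
theorem norm_iteratedFDeriv_dilate_le {η : E → ℝ} (hη : η.HasTemperateGrowth)
    (h0 : ∀ x ∈ Metric.ball (0 : E) 1, η x = 0) (m : ℕ) :
    ∃ (C : ℝ) (p : ℕ), 0 ≤ C ∧ ∀ a : ℝ, 0 < a → a ≤ 1 → ∀ i ≤ m, ∀ x : E,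
      ‖iteratedFDeriv ℝ i (fun y => η (a • y)) x‖ ≤ a * (C * (1 + ‖x‖) ^ p) := by
  obtain ⟨p, C, hC, h⟩ := hη.norm_iteratedFDeriv_le_uniform m
  refine ⟨C, p + 1, hC, fun a ha ha1 i hi x => ?_⟩
  have hsm : ContDiff ℝ i η := hη.1.of_le (mod_cast le_top)
  have hcomp := iteratedFDeriv_comp_const_smul (𝕜 := ℝ) (i := i) a hsm
  have hx0 := norm_nonneg x
  rw [hcomp]
  by_cases hx : ‖a • x‖ < 1
  · have hz : iteratedFDeriv ℝ i η (a • x) = 0 := by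
      have : η =ᶠ[𝓝 (a • x)] fun _ => 0 := by
        filter_upwards [Metric.isOpen_ball.mem_nhds
          (show a • x ∈ Metric.ball (0 : E) 1 by simpa using hx)] with y hy using h0 y hy
      rw [(this.iteratedFDeriv ℝ i).self_of_nhds]
      simp
    simp only [hz, smul_zero, norm_zero]
    positivity
  · push Not at hx
    rw [norm_smul, norm_pow, Real.norm_of_nonneg ha.le]
    have h1 : ‖a • x‖ = a * ‖x‖ := by rw [norm_smul, Real.norm_of_nonneg ha.le]
    calc a ^ i * ‖iteratedFDeriv ℝ i η (a • x)‖ ≤ 1 * (C * (1 + ‖a • x‖) ^ p) := by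
          gcongr
          · exact pow_le_one₀ ha.le ha1
          · exact h i hi _
      _ ≤ (a * ‖x‖) * (C * (1 + ‖x‖) ^ p) := by
          rw [h1] at hx ⊢
          gcongr
          nlinarith
      _ ≤ a * (C * (1 + ‖x‖) ^ (p + 1)) := by
          rw [pow_succ]
          have : 0 ≤ a * (C * (1 + ‖x‖) ^ p) := by positivity
          nlinarith

/-- Every Schwartz function is a limit of compactly supported ones which it dominates. -/
theorem exists_tendsto_hasCompactSupport [FiniteDimensional ℝ E] (v : 𝓢(E, ℂ)) :
    ∃ w : ℕ → 𝓢(E, ℂ), (∀ n, HasCompactSupport (w n)) ∧ (∀ n x, ‖w n x‖ ≤ ‖v x‖) ∧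
      Tendsto w atTop (𝓝 v) := by
  let χ : ContDiffBump (0 : E) := ⟨1, 2, one_pos, one_lt_two⟩
  have hχ : (χ : E → ℝ).HasTemperateGrowth := χ.hasCompactSupport.hasTemperateGrowth χ.contDiff
  let a : ℕ → ℝ := fun n => 1 / ((n : ℝ) + 1)
  have ha : ∀ n, 0 < a n := fun n => by positivity
  have ha1 : ∀ n, a n ≤ 1 := fun n => by
    simp only [a]; rw [div_le_one (by positivity)]; linarith [(Nat.cast_nonneg n : (0 : ℝ) ≤ n)]
  have hsmul : ∀ n, (fun x : E => a n • x).HasTemperateGrowth := fun n =>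
    (a n • ContinuousLinearMap.id ℝ E).hasTemperateGrowth
  have hg : ∀ n, (fun x : E => χ (a n • x)).HasTemperateGrowth := fun n => hχ.comp (hsmul n)
  let w : ℕ → 𝓢(E, ℂ) := fun n => SchwartzMap.smulLeftCLM ℂ (fun x : E => χ (a n • x)) v
  have hw : ∀ n x, w n x = χ (a n • x) • v x := fun n x =>
    SchwartzMap.smulLeftCLM_apply_apply (hg n) v x
  refine ⟨w, fun n => ?_, fun n x => ?_, ?_⟩
  · have h1 : HasCompactSupport (fun x : E => χ (a n • x)) :=
      χ.hasCompactSupport.comp_homeomorph (Homeomorph.smulOfNeZero (a n) (ha n).ne')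
    exact h1.of_isClosed_subset (isClosed_tsupport _)
      ((SchwartzMap.tsupport_smulLeftCLM_subset _ _).trans Set.inter_subset_right)
  · rw [hw, norm_smul, Real.norm_of_nonneg χ.nonneg]
    exact mul_le_of_le_one_left (norm_nonneg _) χ.le_one
  · rw [(schwartz_withSeminorms ℝ E ℂ).tendsto_nhds]
    rintro ⟨k, m⟩ ε hε
    have hη : (fun x : E => χ x - 1).HasTemperateGrowth :=
      hχ.sub (Function.HasTemperateGrowth.const 1)
    obtain ⟨C, p, hC, hbd⟩ := norm_iteratedFDeriv_dilate_le hη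
      (fun x hx => by
        rw [χ.one_of_mem_closedBall (Metric.ball_subset_closedBall hx), sub_self]) m
    let S : ℝ := 2 ^ (k + p) * ((Finset.Iic (k + p, m)).sup
      fun m : ℕ × ℕ => SchwartzMap.seminorm ℝ m.1 m.2) v
    have hS : ∀ j ≤ m, ∀ x, (1 + ‖x‖) ^ (k + p) * ‖iteratedFDeriv ℝ j v x‖ ≤ S := fun j hj x =>
      SchwartzMap.one_add_le_sup_seminorm_apply (𝕜 := ℝ) (m := (k + p, m)) le_rfl hj v x
    have hS0 : 0 ≤ S := le_trans (by positivity) (hS 0 (Nat.zero_le _) 0)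
    have key : ∀ n, SchwartzMap.seminorm ℝ k m (w n - v) ≤ a n * (C * 2 ^ m * S) := by
      intro n
      have han := ha n
      refine SchwartzMap.seminorm_le_bound ℝ k m _ (by positivity) fun x => ?_
      have hfun : (⇑(w n - v) : E → ℂ) = fun y => (χ (a n • y) - 1) • v y := by
        ext y
        rw [sub_apply, hw, sub_smul, one_smul]
      have hc1 : ContDiff ℝ m (fun y : E => χ (a n • y) - 1) :=
        ((hη.comp (hsmul n)).1).of_le (mod_cast le_top)
      have hle := norm_iteratedFDeriv_smul_le hc1 (v.smooth m) x (n := m) le_rfl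
      rw [hfun]
      calc _ ≤ ‖x‖ ^ k * ∑ i ∈ Finset.range (m + 1), (m.choose i : ℝ) *
            ‖iteratedFDeriv ℝ i (fun y : E => χ (a n • y) - 1) x‖ *
            ‖iteratedFDeriv ℝ (m - i) v x‖ := by gcongr
        _ ≤ ∑ i ∈ Finset.range (m + 1), (m.choose i : ℝ) * (a n * (C * S)) := by
            rw [Finset.mul_sum]
            refine Finset.sum_le_sum fun i hi => ?_
            have hi' : i ≤ m := Nat.lt_succ_iff.mp (Finset.mem_range.mp hi)
            have h1 := hbd (a n) (ha n) (ha1 n) i hi' x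
            have h2 := hS (m - i) (Nat.sub_le _ _) x
            have h3 : ‖x‖ ^ k ≤ (1 + ‖x‖) ^ k := by gcongr; linarith
            calc _ ≤ (1 + ‖x‖) ^ k * ((m.choose i : ℝ) * (a n * (C * (1 + ‖x‖) ^ p)) *
                  ‖iteratedFDeriv ℝ (m - i) v x‖) := by gcongr
              _ = (m.choose i : ℝ) * (a n * (C * ((1 + ‖x‖) ^ (k + p) *
                  ‖iteratedFDeriv ℝ (m - i) v x‖))) := by rw [pow_add]; ring
              _ ≤ _ := by gcongr
        _ = _ := by
            rw [← Finset.sum_mul, ← Nat.cast_sum, Nat.sum_range_choose]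
            push_cast; ring
    have hlim : Tendsto (fun n => a n * (C * 2 ^ m * S)) atTop (𝓝 0) := by
      simpa [a] using (tendsto_one_div_add_atTop_nhds_zero_nat (𝕜 := ℝ)).mul_const (C * 2 ^ m * S)
    filter_upwards [hlim.eventually (gt_mem_nhds hε)] with n hn
    exact (key n).trans_lt hn

end Density

/-! ### Measure-theoretic tools: sup bounds by duality, and the layer cake. -/

/-- Test against normalized bumps shrinking to `x`: their `L¹` norm is `1`, and the pairings
converge to `h x` at almost every `x`. -/
theorem ae_norm_le_of_isFunction {S : 𝓢'(R3, ℂ)} {h : R3 → ℂ} (hS : IsFunction S h) {B : ℝ}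
    (hB : ∀ u : 𝓢(R3, ℂ), HasCompactSupport u → ‖S u‖ ≤ B * ∫ x, ‖u x‖) :
    ∀ᵐ x, ‖h x‖ ≤ B := by
  let ψ : ℕ → ContDiffBump (0 : R3) := fun n =>
    ⟨1 / ((n : ℝ) + 1), 2 * (1 / ((n : ℝ) + 1)), by positivity,
      by have : 0 < 1 / ((n : ℝ) + 1) := by positivity
         linarith⟩
  have hlim : Tendsto (fun n => (ψ n).rOut) atTop (𝓝 0) := by
    simpa [ψ] using (tendsto_one_div_add_atTop_nhds_zero_nat (𝕜 := ℝ)).const_mul 2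
  filter_upwards [ContDiffBump.ae_convolution_tendsto_right_of_locallyIntegrable (μ := volume)
    (φ := ψ) (K := 2) hlim (Eventually.of_forall fun n => le_rfl) hS.1] with x hx
  refine le_of_tendsto hx.norm (Eventually.of_forall fun n => ?_)
  rw [convolution_eq_swap]
  have hc : HasCompactSupport (fun y : R3 => (((ψ n).normed volume (x - y) : ℝ) : ℂ)) :=
    (((ψ n).hasCompactSupport_normed (μ := volume)).comp_homeomorph
      (Homeomorph.subLeft x)).comp_left (g := fun t : ℝ => (t : ℂ)) Complex.ofReal_zero
  have hs : ContDiff ℝ (⊤ : ℕ∞) (fun y : R3 => (((ψ n).normed volume (x - y) : ℝ) : ℂ)) :=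
    Complex.ofRealCLM.contDiff.comp
      (((ψ n).contDiff_normed (μ := volume)).comp (contDiff_const.sub contDiff_id))
  have h1 := hS.2 (hc.toSchwartzMap hs) hc
  have h2 := hB (hc.toSchwartzMap hs) hc
  have h3 : ∫ y, ‖(hc.toSchwartzMap hs) y‖ = 1 := by
    have : ∀ y, ‖(hc.toSchwartzMap hs) y‖ = (ψ n).normed volume (x - y) := fun y => by
      simp [Real.norm_of_nonneg ((ψ n).nonneg_normed _)]
    simp_rw [this]
    rw [integral_sub_left_eq_self (fun y => (ψ n).normed volume y)]
    exact (ψ n).integral_normed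
  rw [h3, mul_one, h1] at h2
  simpa using h2

/-- Layer cake on both sides: `q t^(q-1) · 4 / t²` is a multiple of `t^(q-3)`, the density that
recovers `ρ^(q-2)`; this needs `q > 2`. -/
theorem lintegral_rpow_le_of_meas_le {α β : Type*} [MeasurableSpace α] [MeasurableSpace β]
    {μ : Measure α} {κ : Measure β} {h : α → ℝ} {ρ : β → ℝ} (h0 : ∀ a, 0 ≤ h a)
    (hh : AEMeasurable h μ) (ρ0 : ∀ b, 0 ≤ ρ b) (hρ : Measurable ρ) {q : ℝ} (hq : 2 < q)
    (H : ∀ t : ℝ, 0 < t → μ {a | t < h a} ≤ ENNReal.ofReal (4 / t ^ 2) * κ {b | t ≤ ρ b}) :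
    ∫⁻ a, ENNReal.ofReal (h a ^ q) ∂μ ≤
      ENNReal.ofReal (4 * q / (q - 2)) * ∫⁻ b, ENNReal.ofReal (ρ b ^ (q - 2)) ∂κ := by
  have hq2 : 0 < q - 2 := by linarith
  rw [lintegral_rpow_eq_lintegral_meas_lt_mul μ (Eventually.of_forall h0) hh (by linarith),
    lintegral_rpow_eq_lintegral_meas_le_mul κ (Eventually.of_forall ρ0) hρ.aemeasurable hq2,
    ← mul_assoc, ← ENNReal.ofReal_mul (by positivity), div_mul_cancel₀ _ hq2.ne',
    mul_comm 4 q, ENNReal.ofReal_mul (by linarith : 0 ≤ q), mul_assoc]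
  gcongr
  rw [← lintegral_const_mul' _ _ ENNReal.ofReal_ne_top]
  refine setLIntegral_mono' measurableSet_Ioi fun t ht => ?_
  have ht' : 0 < t := ht
  calc _ ≤ (ENNReal.ofReal (4 / t ^ 2) * κ {b | t ≤ ρ b}) * ENNReal.ofReal (t ^ (q - 1)) := by
        gcongr; exact H t ht'
    _ = ENNReal.ofReal (4 / t ^ 2 * t ^ (q - 1)) * κ {b | t ≤ ρ b} := by
        rw [ENNReal.ofReal_mul (by positivity)]; ring
    _ = ENNReal.ofReal (4 * t ^ (q - 2 - 1)) * κ {b | t ≤ ρ b} := by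
        congr 2
        rw [show q - 1 = (q - 2 - 1) + 2 by ring, Real.rpow_add ht']
        rw [show t ^ (2 : ℝ) = t ^ 2 by norm_cast]
        field_simp
    _ = _ := by rw [ENNReal.ofReal_mul (by norm_num)]; ring

/-! ### Littlewood-Paley symbols and the `L²` theory of the high-frequency part. -/

theorem IsLittlewoodPaleyBump.hasCompactSupport {φ : R3 → ℝ} (hφ : IsLittlewoodPaleyBump φ) :
    HasCompactSupport φ :=
  (isCompact_closedBall (0 : R3) 2).of_isClosed_subset (isClosed_tsupport φ) hφ.tsupport_subset

/-- The symbol of the projection to frequencies at most `M`. -/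
noncomputable def lowSymbol (φ : R3 → ℝ) (M : ℝ) (ξ : R3) : ℂ :=
  (φ ((2 * Real.pi / M) • ξ) : ℂ)

/-- The symbol of the projection to frequencies at least `M`. -/
noncomputable def highSymbol (φ : R3 → ℝ) (M : ℝ) (ξ : R3) : ℂ :=
  ((1 - φ ((2 * Real.pi / M) • ξ) : ℝ) : ℂ)

section Symbols
variable {φ : R3 → ℝ} {M : ℝ}

theorem lowSymbol_contDiff (hφ : IsLittlewoodPaleyBump φ) : ContDiff ℝ (⊤ : ℕ∞) (lowSymbol φ M) :=
  Complex.ofRealCLM.contDiff.comp (hφ.contDiff.comp (contDiff_const_smul _))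

theorem lowSymbol_hasCompactSupport (hφ : IsLittlewoodPaleyBump φ) (hM : 0 < M) : HasCompactSupport (lowSymbol φ M) :=
  (hφ.hasCompactSupport.comp_homeomorph
    (Homeomorph.smulOfNeZero (2 * Real.pi / M) (by positivity))).comp_left
      (g := fun t : ℝ => (t : ℂ)) Complex.ofReal_zero

theorem lowSymbol_hasTemperateGrowth (hφ : IsLittlewoodPaleyBump φ) (hM : 0 < M) : (lowSymbol φ M).HasTemperateGrowth :=
  (lowSymbol_hasCompactSupport hφ hM).hasTemperateGrowth (lowSymbol_contDiff hφ)

theorem highSymbol_eq : highSymbol φ M = (fun _ => (1 : ℂ)) - lowSymbol φ M := by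
  ext ξ; simp [highSymbol, lowSymbol]

theorem highSymbol_hasTemperateGrowth (hφ : IsLittlewoodPaleyBump φ) (hM : 0 < M) : (highSymbol φ M).HasTemperateGrowth := by
  rw [highSymbol_eq]
  exact (Function.HasTemperateGrowth.const 1).sub (lowSymbol_hasTemperateGrowth hφ hM)

theorem norm_lowSymbol_le (hφ : IsLittlewoodPaleyBump φ) (ξ : R3) : ‖lowSymbol φ M ξ‖ ≤ 1 := by
  rw [lowSymbol, Complex.norm_real, Real.norm_of_nonneg (hφ.nonneg _)]
  exact hφ.le_one _

theorem norm_highSymbol_le (hφ : IsLittlewoodPaleyBump φ) (ξ : R3) : ‖highSymbol φ M ξ‖ ≤ 1 := by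
  rw [highSymbol, Complex.norm_real, Real.norm_of_nonneg (sub_nonneg.mpr (hφ.le_one _))]
  linarith [hφ.nonneg ((2 * Real.pi / M) • ξ)]

theorem norm_freq (hM : 0 < M) (ξ : R3) : ‖(2 * Real.pi / M) • ξ‖ = 2 * Real.pi * ‖ξ‖ / M := by
  rw [norm_smul, Real.norm_of_nonneg (by positivity)]; ring

theorem highSymbol_eq_zero (hφ : IsLittlewoodPaleyBump φ) (hM : 0 < M) {ξ : R3} (h : 2 * Real.pi * ‖ξ‖ < M) : highSymbol φ M ξ = 0 := by
  rw [highSymbol, hφ.eq_one]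
  · simp
  · rw [mem_ball_zero_iff, norm_freq hM, div_lt_one hM]
    exact h

theorem lowSymbol_eq_zero (hφ : IsLittlewoodPaleyBump φ) (hM : 0 < M) {ξ : R3} (h : 2 * M < 2 * Real.pi * ‖ξ‖) : lowSymbol φ M ξ = 0 := by
  rw [lowSymbol, Complex.ofReal_eq_zero]
  by_contra hne
  have := hφ.tsupport_subset (subset_tsupport _ hne)
  rw [mem_closedBall_zero_iff, norm_freq hM, div_le_iff₀ hM] at this
  linarith

end Symbols

/-- `IsFunction` speaks only of compactly supported test functions; density and continuity of both
sides extend the identity to all Schwartz functions. -/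
theorem smulLeftCLM_eq_toTemperedDistribution {S : 𝓢'(R3, ℂ)} {g : R3 → ℂ} (hg : IsFunction S g)
    {m : R3 → ℂ} (hm : m.HasTemperateGrowth) (G : Lp ℂ 2 (volume : Measure R3))
    (hG : G =ᵐ[volume] fun ξ => m ξ * g ξ) :
    TemperedDistribution.smulLeftCLM ℂ m S = (G : 𝓢'(R3, ℂ)) := by
  ext v
  obtain ⟨w, hwc, -, hw⟩ := exists_tendsto_hasCompactSupport v
  have h1 := ((TemperedDistribution.smulLeftCLM ℂ m S).continuous.tendsto v).comp hw
  have h2 := ((G : 𝓢'(R3, ℂ)).continuous.tendsto v).comp hw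
  refine tendsto_nhds_unique h1 (h2.congr fun n => ?_)
  refine (Lp.toTemperedDistribution_apply G (w n)).trans (Eq.trans (integral_congr_ae ?_)
    (hg.2 (SchwartzMap.smulLeftCLM ℂ m (w n)) ((hwc n).of_isClosed_subset (isClosed_tsupport _)
      ((SchwartzMap.tsupport_smulLeftCLM_subset _ _).trans Set.inter_subset_left))).symm)
  filter_upwards [hG] with ξ hξ
  rw [hξ, SchwartzMap.smulLeftCLM_apply_apply hm, smul_eq_mul, smul_eq_mul]
  ring

/-- Plancherel: the symbol is at most `1` and vanishes for `|ω| < M`, so its product with `g` is in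
`L²`, and `h` is the inverse transform of that product. -/
theorem exists_isFunction_projGE {φ : R3 → ℝ} (hφ : IsLittlewoodPaleyBump φ) {T : 𝓢'(R3, ℂ)}
    {g : R3 → ℂ} (hg : IsFunction (𝓕 T) g) {M : ℝ} (hM : 0 < M)
    (hfin : ∫⁻ ξ in {ξ : R3 | M ≤ 2 * Real.pi * ‖ξ‖}, ‖g ξ‖ₑ ^ 2 ≠ ⊤) :
    ∃ h : R3 → ℂ, AEStronglyMeasurable h volume ∧ IsFunction (projGE φ M T) h ∧
      ∫⁻ x, ‖h x‖ₑ ^ 2 ≤ ∫⁻ ξ in {ξ : R3 | M ≤ 2 * Real.pi * ‖ξ‖}, ‖g ξ‖ₑ ^ 2 := by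
  have hm := highSymbol_hasTemperateGrowth hφ hM
  have hmeas : AEStronglyMeasurable (fun ξ => highSymbol φ M ξ * g ξ) volume :=
    hm.1.continuous.aestronglyMeasurable.mul hg.1.aestronglyMeasurable
  have hset : MeasurableSet {ξ : R3 | M ≤ 2 * Real.pi * ‖ξ‖} :=
    measurableSet_le measurable_const (by fun_prop)
  have hle : ∫⁻ ξ, ‖highSymbol φ M ξ * g ξ‖ₑ ^ 2 ≤
      ∫⁻ ξ in {ξ : R3 | M ≤ 2 * Real.pi * ‖ξ‖}, ‖g ξ‖ₑ ^ 2 := by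
    rw [← lintegral_indicator hset]
    refine lintegral_mono fun ξ => ?_
    by_cases hξ : M ≤ 2 * Real.pi * ‖ξ‖
    · rw [Set.indicator_of_mem (by exact hξ), enorm_mul]
      have : ‖highSymbol φ M ξ‖ₑ ≤ 1 := by
        rw [← ofReal_norm, ENNReal.ofReal_le_one]; exact norm_highSymbol_le hφ ξ
      gcongr
      exact mul_le_of_le_one_left zero_le this
    · rw [highSymbol_eq_zero hφ hM (not_le.mp hξ)]
      simp
  have hL2 (f : R3 → ℂ) : eLpNorm f 2 volume ^ (2 : ℝ) = ∫⁻ x, ‖f x‖ₑ ^ 2 := by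
    rw [eLpNorm_eq_lintegral_rpow_enorm_toReal (by norm_num) (by norm_num), ← ENNReal.rpow_mul]
    norm_num
  have hmem : MemLp (fun ξ => highSymbol φ M ξ * g ξ) 2 volume := by
    refine ⟨hmeas, ?_⟩
    by_contra hcon
    have h2 := hL2 (fun ξ => highSymbol φ M ξ * g ξ)
    rw [top_le_iff.mp (not_lt.mp hcon), ENNReal.top_rpow_of_pos two_pos] at h2
    exact hfin (top_le_iff.mp (h2 ▸ hle))
  let G : Lp ℂ 2 (volume : Measure R3) := hmem.toLp _
  have hGm := smulLeftCLM_eq_toTemperedDistribution hg hm G hmem.coeFn_toLp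
  let F : Lp ℂ 2 (volume : Measure R3) := 𝓕⁻ G
  have hproj : projGE φ M T = Lp.toTemperedDistribution F := by
    rw [← Lp.fourierInv_toTemperedDistribution_eq, ← hGm]
    rfl
  refine ⟨F, (Lp.memLp _).1,
    ⟨(Lp.memLp _).locallyIntegrable (by norm_num), fun u _ => ?_⟩, ?_⟩
  · rw [hproj, Lp.toTemperedDistribution_apply]
    rfl
  · rw [← hL2]
    have h1 : eLpNorm F 2 volume = eLpNorm G 2 volume := by
      rw [← Lp.enorm_def, ← Lp.enorm_def, ← ofReal_norm, ← ofReal_norm]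
      congr 1
      rw [← Lp.norm_fourier_eq, FourierTransform.fourier_fourierInv_eq]
    rw [h1, eLpNorm_congr_ae hmem.coeFn_toLp, hL2]
    exact hle

theorem finrank_R3 : Module.finrank ℝ R3 = 3 := by simp

theorem lintegral_comp_smul_R3 (F : R3 → ℝ≥0∞) {a : ℝ} (ha : 0 < a) :
    ∫⁻ x, F (a • x) = ENNReal.ofReal ((a ^ 3)⁻¹) * ∫⁻ x, F x := by
  have h := (lintegral_map_equiv (μ := (volume : Measure R3)) F
    (Homeomorph.smulOfNeZero a ha.ne').toMeasurableEquiv).symm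
  have h2 : Measure.map (Homeomorph.smulOfNeZero a ha.ne').toMeasurableEquiv
      (volume : Measure R3) = ENNReal.ofReal ((a ^ 3)⁻¹) • volume := by
    have := Measure.map_addHaar_smul (volume : Measure R3) ha.ne'
    rw [finrank_R3, abs_of_pos (by positivity)] at this
    exact this
  rw [h2, lintegral_smul_measure] at h
  exact h

/-! ### Low frequencies bounded by the homogeneous Sobolev norm. -/

section FrequencyBall

theorem integrableOn_norm_rpow_ball {σ : ℝ} (hσ : σ < 3) :
    Integrable (fun x : R3 => Set.indicator (Set.Ioc 0 1) (fun t : ℝ => t ^ (-σ)) ‖x‖) := by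
  rw [integrable_fun_norm_addHaar (volume : Measure R3)
    (f := Set.indicator (Set.Ioc 0 1) (fun t : ℝ => t ^ (-σ))), finrank_R3]
  have h : IntegrableOn (fun t : ℝ => t ^ (2 - σ)) (Set.Ioc 0 1) :=
    (intervalIntegrable_iff_integrableOn_Ioc_of_le zero_le_one).mp
      (intervalIntegral.intervalIntegrable_rpow' (by linarith))
  have h2 := h.integrable_indicator measurableSet_Ioc
  refine (h2.integrableOn (s := Set.Ioi 0)).congr_fun (fun t ht => ?_) measurableSet_Ioi
  by_cases h1 : t ∈ Set.Ioc (0 : ℝ) 1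
  · simp only [Set.indicator_of_mem h1, smul_eq_mul]
    rw [sub_eq_add_neg, Real.rpow_add h1.1]
    norm_num
  · simp only [Set.indicator_of_notMem h1, smul_zero]

/-- The square of the homogeneous weight of order `-s` has a bounded integral over a ball of
frequencies, uniformly in `s` bounded away from the critical order. -/
theorem exists_lintegral_freq_rpow_le {s₁ : ℝ} (hs₁ : s₁ < 3 / 2) :
    ∃ C : ℝ, 0 < C ∧ ∀ s : ℝ, 0 < s → s ≤ s₁ → ∀ M : ℝ, 0 < M →
      ∫⁻ ξ in {ξ : R3 | 2 * Real.pi * ‖ξ‖ ≤ 2 * M},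
        ENNReal.ofReal ((2 * Real.pi * ‖ξ‖) ^ (-(2 * s))) ≤
      ENNReal.ofReal (C * M ^ (3 - 2 * s)) := by
  have hπ := Real.pi_pos
  -- After rescaling by `M`, this integrable function dominates `|η|^(-2s)` on `|η| ≤ 2` for every
  -- `s ≤ s₁` at once, which makes the constant uniform.
  let F : R3 → ℝ≥0∞ := fun η =>
    Set.indicator {η : R3 | ‖η‖ ≤ 2} 1 η + ‖Set.indicator (Set.Ioc 0 1)
      (fun t : ℝ => t ^ (-(2 * s₁))) ‖η‖‖ₑ
  have hF : ∫⁻ η, F η ≠ ⊤ := by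
    have hm : MeasurableSet {η : R3 | ‖η‖ ≤ 2} := measurableSet_le (by fun_prop) measurable_const
    rw [lintegral_add_left (measurable_one.indicator hm)]
    refine ENNReal.add_ne_top.mpr ⟨?_, (integrableOn_norm_rpow_ball (by linarith)).2.ne⟩
    rw [lintegral_indicator_one hm]
    have : {η : R3 | ‖η‖ ≤ 2} = Metric.closedBall 0 2 := by ext; simp
    rw [this]
    exact measure_closedBall_lt_top.ne
  refine ⟨(∫⁻ η, F η).toReal + 1, by positivity, fun s hs hs1 M hM => ?_⟩
  have hset : MeasurableSet {ξ : R3 | 2 * Real.pi * ‖ξ‖ ≤ 2 * M} :=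
    measurableSet_le (by fun_prop) measurable_const
  have ha : 0 < 2 * Real.pi / M := by positivity
  have hpt : ∀ ξ : R3, Set.indicator {ξ : R3 | 2 * Real.pi * ‖ξ‖ ≤ 2 * M}
      (fun ξ => ENNReal.ofReal ((2 * Real.pi * ‖ξ‖) ^ (-(2 * s)))) ξ ≤
      ENNReal.ofReal (M ^ (-(2 * s))) * F ((2 * Real.pi / M) • ξ) := by
    intro ξ
    refine Set.indicator_apply_le' (fun hξ => ?_) (fun _ => zero_le)
    set t := ‖(2 * Real.pi / M) • ξ‖ with ht
    have ht0 : 0 ≤ t := norm_nonneg _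
    have hω : 2 * Real.pi * ‖ξ‖ = M * t := by
      rw [ht, norm_freq hM]; field_simp
    have ht2 : t ≤ 2 := by
      have : M * t ≤ 2 * M := hω ▸ hξ
      nlinarith
    rw [hω, Real.mul_rpow hM.le ht0, ENNReal.ofReal_mul (by positivity)]
    gcongr
    simp only [F, ← ht]
    rw [Set.indicator_of_mem (by exact ht2), Pi.one_apply]
    by_cases h1 : t ∈ Set.Ioc (0 : ℝ) 1
    · rw [Set.indicator_of_mem h1, ← ofReal_norm, Real.norm_of_nonneg (by positivity)]
      refine le_trans (ENNReal.ofReal_le_ofReal ?_) le_add_self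
      exact Real.rpow_le_rpow_of_exponent_ge h1.1 h1.2 (by linarith)
    · refine le_trans ?_ le_self_add
      rw [ENNReal.ofReal_le_one]
      rcases eq_or_lt_of_le ht0 with h0 | h0
      · rw [← h0, Real.zero_rpow (by linarith)]; exact zero_le_one
      · have : 1 < t := by
          by_contra hcon
          exact h1 ⟨h0, not_lt.mp hcon⟩
        exact Real.rpow_le_one_of_one_le_of_nonpos this.le (by linarith)
  rw [← lintegral_indicator hset]
  calc _ ≤ ∫⁻ ξ, ENNReal.ofReal (M ^ (-(2 * s))) * F ((2 * Real.pi / M) • ξ) :=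
        lintegral_mono hpt
    _ = ENNReal.ofReal (M ^ (-(2 * s))) * (ENNReal.ofReal (((2 * Real.pi / M) ^ 3)⁻¹) *
          ∫⁻ η, F η) := by
        rw [lintegral_const_mul' _ _ ENNReal.ofReal_ne_top, lintegral_comp_smul_R3 F ha]
    _ ≤ ENNReal.ofReal (M ^ (-(2 * s))) * (ENNReal.ofReal (M ^ 3) *
          ENNReal.ofReal ((∫⁻ η, F η).toReal + 1)) := by
        gcongr
        · rw [div_pow, inv_div]
          refine div_le_self (by positivity) (one_le_pow₀ ?_)
          linarith [Real.pi_gt_three]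
        · rw [ENNReal.le_ofReal_iff_toReal_le hF (by positivity)]
          linarith
    _ = _ := by
        rw [← ENNReal.ofReal_mul (by positivity), ← ENNReal.ofReal_mul (by positivity)]
        congr 1
        rw [show (3 : ℝ) - 2 * s = -(2 * s) + (3 : ℕ) by push_cast; ring, Real.rpow_add hM,
          Real.rpow_natCast]
        ring

/-- Cauchy-Schwarz after splitting `1 = |ω|^(-s) |ω|^s` on the ball `|ω| ≤ 2M` containing the
support of the symbol. -/
theorem exists_lintegral_lowSymbol_mul_le {φ : R3 → ℝ} (hφ : IsLittlewoodPaleyBump φ)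
    {s₁ : ℝ} (hs₁ : s₁ < 3 / 2) :
    ∃ C : ℝ, 1 ≤ C ∧ ∀ s : ℝ, 0 < s → s ≤ s₁ → ∀ M : ℝ, 0 < M → ∀ g : R3 → ℂ,
      AEStronglyMeasurable g volume →
      ∫⁻ ξ, ‖lowSymbol φ M ξ * g ξ‖ₑ ≤ ENNReal.ofReal (C * M ^ (3 / 2 - s)) *
        (∫⁻ ξ, ENNReal.ofReal ((2 * Real.pi * ‖ξ‖) ^ (2 * s)) * ‖g ξ‖ₑ ^ 2) ^ (1 / 2 : ℝ) := by
  obtain ⟨C, hC, h⟩ := exists_lintegral_freq_rpow_le hs₁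
  refine ⟨C ^ (1 / 2 : ℝ) + 1, by linarith [Real.rpow_pos_of_pos hC (1 / 2)],
    fun s hs hs1 M hM g hg => ?_⟩
  have hπ := Real.pi_pos
  have hset : MeasurableSet {ξ : R3 | 2 * Real.pi * ‖ξ‖ ≤ 2 * M} :=
    measurableSet_le (by fun_prop) measurable_const
  let a : R3 → ℝ≥0∞ := Set.indicator {ξ : R3 | 2 * Real.pi * ‖ξ‖ ≤ 2 * M}
    fun ξ => ENNReal.ofReal ((2 * Real.pi * ‖ξ‖) ^ (-s))
  let b : R3 → ℝ≥0∞ := fun ξ => ENNReal.ofReal ((2 * Real.pi * ‖ξ‖) ^ s) * ‖g ξ‖ₑ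
  have ham : Measurable a := Measurable.indicator (by fun_prop) hset
  have hbm : AEMeasurable b volume := by
    refine AEMeasurable.mul (Measurable.aemeasurable (by fun_prop)) hg.enorm
  -- The origin is excluded because both real powers take the value `0` there.
  have hab : ∀ᵐ ξ : R3, ‖lowSymbol φ M ξ * g ξ‖ₑ ≤ (a * b) ξ := by
    filter_upwards [(measure_eq_zero_iff_ae_notMem.mp
      (measure_singleton (μ := (volume : Measure R3)) 0))] with ξ hξ0
    have hξ : 0 < ‖ξ‖ := norm_pos_iff.mpr (by simpa using hξ0)
    by_cases hξ' : 2 * Real.pi * ‖ξ‖ ≤ 2 * M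
    · have h1 : (a * b) ξ = ‖g ξ‖ₑ := by
        simp only [Pi.mul_apply, a, b]
        rw [Set.indicator_of_mem (by exact hξ'), ← mul_assoc,
          ← ENNReal.ofReal_mul (by positivity), ← Real.rpow_add (by positivity)]
        simp
      rw [h1, enorm_mul]
      refine mul_le_of_le_one_left zero_le ?_
      rw [← ofReal_norm, ENNReal.ofReal_le_one]
      exact norm_lowSymbol_le hφ ξ
    · rw [lowSymbol_eq_zero hφ hM (not_le.mp hξ')]
      simp
  have hpow : ∀ (t r : ℝ), 0 ≤ t → ENNReal.ofReal (t ^ r) ^ (2 : ℝ) =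
      ENNReal.ofReal (t ^ (2 * r)) := fun t r ht => by
    rw [ENNReal.ofReal_rpow_of_nonneg (by positivity) (by norm_num), ← Real.rpow_mul ht,
      mul_comm r]
  have ha2 : ∫⁻ ξ, a ξ ^ (2 : ℝ) ≤ ENNReal.ofReal (C * M ^ (3 - 2 * s)) := by
    refine le_trans (le_of_eq ?_) (h s hs hs1 M hM)
    rw [← lintegral_indicator hset]
    refine lintegral_congr fun ξ => ?_
    by_cases hξ' : ξ ∈ {ξ : R3 | 2 * Real.pi * ‖ξ‖ ≤ 2 * M}
    · simp only [a]
      rw [Set.indicator_of_mem hξ', Set.indicator_of_mem hξ', hpow _ _ (by positivity)]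
      congr 2; ring
    · simp only [a]
      rw [Set.indicator_of_notMem hξ', Set.indicator_of_notMem hξ', ENNReal.zero_rpow_of_pos two_pos]
  have hb2 : ∫⁻ ξ, b ξ ^ (2 : ℝ) =
      ∫⁻ ξ, ENNReal.ofReal ((2 * Real.pi * ‖ξ‖) ^ (2 * s)) * ‖g ξ‖ₑ ^ 2 := by
    refine lintegral_congr fun ξ => ?_
    simp only [b]
    rw [ENNReal.mul_rpow_of_nonneg _ _ two_pos.le, hpow _ _ (by positivity)]
    norm_cast
  calc _ ≤ ∫⁻ ξ, (a * b) ξ := lintegral_mono_ae hab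
    _ ≤ (∫⁻ ξ, a ξ ^ (2 : ℝ)) ^ (1 / 2 : ℝ) * (∫⁻ ξ, b ξ ^ (2 : ℝ)) ^ (1 / 2 : ℝ) :=
        ENNReal.lintegral_mul_le_Lp_mul_Lq _ Real.HolderConjugate.two_two ham.aemeasurable hbm
    _ ≤ ENNReal.ofReal (C * M ^ (3 - 2 * s)) ^ (1 / 2 : ℝ) * _ := by
        rw [hb2]; gcongr
    _ ≤ _ := by
        gcongr
        rw [ENNReal.ofReal_rpow_of_nonneg (by positivity) (by norm_num)]
        refine ENNReal.ofReal_le_ofReal ?_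
        rw [Real.mul_rpow hC.le (by positivity), ← Real.rpow_mul hM.le,
          show (3 - 2 * s) * (1 / 2) = 3 / 2 - s by ring]
        gcongr
        linarith

end FrequencyBall

/-- Low frequency cutoffs are bounded through the homogeneous Sobolev norm. -/
theorem enorm_lowpass_apply_le {φ : R3 → ℝ} (hφ : IsLittlewoodPaleyBump φ) {T : 𝓢'(R3, ℂ)}
    {g : R3 → ℂ} (hg : IsFunction (𝓕 T) g) {M : ℝ} (hM : 0 < M) (u : 𝓢(R3, ℂ)) :
    ‖TemperedDistribution.fourierMultiplierCLM ℂ (lowSymbol φ M) T u‖ₑ ≤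
      (∫⁻ ξ, ‖lowSymbol φ M ξ * g ξ‖ₑ) * ∫⁻ x, ‖u x‖ₑ := by
  have hc : HasCompactSupport (SchwartzMap.smulLeftCLM ℂ (lowSymbol φ M) (𝓕⁻ u)) :=
    (lowSymbol_hasCompactSupport hφ hM).of_isClosed_subset (isClosed_tsupport _)
      ((SchwartzMap.tsupport_smulLeftCLM_subset _ _).trans Set.inter_subset_right)
  have h1 := hg.2 _ hc
  rw [TemperedDistribution.fourier_apply] at h1
  rw [TemperedDistribution.fourierMultiplierCLM_apply_apply, h1]
  refine (enorm_integral_le_lintegral_enorm _).trans ?_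
  rw [← lintegral_mul_const' _ _ (u.integrable (μ := volume)).2.ne]
  refine lintegral_mono fun ξ => ?_
  rw [SchwartzMap.smulLeftCLM_apply_apply (lowSymbol_hasTemperateGrowth hφ hM), smul_eq_mul,
    mul_right_comm, enorm_mul]
  gcongr
  rw [SchwartzMap.fourierInv_coe, Real.fourierInv_eq]
  refine (enorm_integral_le_lintegral_enorm _).trans (le_of_eq (lintegral_congr fun x => ?_))
  rw [← ofReal_norm, Circle.norm_smul, ofReal_norm]

/-! ### Low frequencies bounded by local `L²` norms. -/

/-- The decaying weight `(1 + |x| / ρ)⁻⁴` at scale `ρ`. -/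
noncomputable def decayWeight (ρ : ℝ) (x : R3) : ℝ≥0∞ :=
  ENNReal.ofReal (((1 + ‖x‖ / ρ) ^ 4)⁻¹)

theorem measurable_decayWeight (ρ : ℝ) : Measurable (decayWeight ρ) := by
  unfold decayWeight; fun_prop

theorem lintegral_decayWeight_ne_top : ∫⁻ x, decayWeight 1 x ≠ ⊤ := by
  have h := finite_integral_one_add_norm (μ := (volume : Measure R3)) (r := 4)
    (by rw [finrank_R3]; norm_num)
  refine (lt_of_le_of_lt (le_of_eq (lintegral_congr fun x => ?_)) h).ne
  rw [decayWeight, div_one, Real.rpow_neg (by positivity)]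
  norm_cast

theorem lintegral_decayWeight {ρ : ℝ} (hρ : 0 < ρ) (x : R3) :
    ∫⁻ z, decayWeight ρ (z - x) = ENNReal.ofReal (ρ ^ 3) * ∫⁻ z, decayWeight 1 z := by
  rw [lintegral_sub_right_eq_self (fun z => decayWeight ρ z)]
  have h := lintegral_comp_smul_R3 (decayWeight 1) (inv_pos.mpr hρ)
  rw [inv_pow, inv_inv] at h
  rw [← h]
  refine lintegral_congr fun z => ?_
  rw [decayWeight, decayWeight, norm_smul, Real.norm_of_nonneg (by positivity), div_one,
    div_eq_inv_mul]

theorem decayWeight_le_of_dist_le {ρ : ℝ} (hρ : 0 < ρ) {x y : R3} (h : ‖x - y‖ ≤ ρ) :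
    decayWeight ρ y ≤ 16 * decayWeight ρ x := by
  rw [decayWeight, decayWeight, show (16 : ℝ≥0∞) = ENNReal.ofReal 16 by norm_num,
    ← ENNReal.ofReal_mul (by norm_num)]
  refine ENNReal.ofReal_le_ofReal ?_
  have h1 : ‖x‖ ≤ ‖y‖ + ρ := by
    have := norm_add_le (x - y) y
    rw [sub_add_cancel] at this
    linarith
  have h2 : 1 + ‖x‖ / ρ ≤ 2 * (1 + ‖y‖ / ρ) := by
    have : ‖x‖ / ρ ≤ ‖y‖ / ρ + 1 := by
      rw [div_add_one hρ.ne']; gcongr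
    have : 0 ≤ ‖y‖ / ρ := by positivity
    linarith
  have h3 : (1 + ‖x‖ / ρ) ^ 4 ≤ 16 * (1 + ‖y‖ / ρ) ^ 4 := by
    calc _ ≤ (2 * (1 + ‖y‖ / ρ)) ^ 4 := by gcongr
      _ = _ := by rw [mul_pow]; norm_num
  rw [← div_eq_mul_inv, inv_le_comm₀ (by positivity) (by positivity), inv_div,
    div_le_iff₀ (by norm_num)]
  linarith

/-- Tonelli, as `y ∈ B(z, ρ)` iff `z ∈ B(y, ρ)`. This averaging over centres replaces a covering by
balls. -/
theorem lintegral_lintegral_ball {F : R3 → ℝ≥0∞} (hF : AEMeasurable F volume) {ρ : ℝ} :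
    ∫⁻ z, ∫⁻ y in Metric.ball z ρ, F y = volume (Metric.ball (0 : R3) ρ) * ∫⁻ y, F y := by
  have hS : MeasurableSet {p : R3 × R3 | dist p.2 p.1 < ρ} :=
    measurableSet_lt (by fun_prop) measurable_const
  have h1 : ∀ z : R3, ∫⁻ y in Metric.ball z ρ, F y =
      ∫⁻ y, Set.indicator {p : R3 × R3 | dist p.2 p.1 < ρ} (fun p => F p.2) (z, y) := fun z => by
    rw [← lintegral_indicator Metric.isOpen_ball.measurableSet]
    rfl
  simp_rw [h1]
  have hswap := lintegral_lintegral_swap (μ := (volume : Measure R3)) (ν := (volume : Measure R3))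
    (f := fun z y => Set.indicator {p : R3 × R3 | dist p.2 p.1 < ρ} (fun p => F p.2) (z, y))
    (AEMeasurable.indicator hF.comp_snd hS)
  rw [hswap,
    ← lintegral_const_mul' _ _ measure_ball_lt_top.ne]
  refine lintegral_congr fun y => ?_
  have h2 : ∀ z : R3, Set.indicator {p : R3 × R3 | dist p.2 p.1 < ρ} (fun p => F p.2) (z, y) =
      Set.indicator (Metric.ball y ρ) (fun _ => F y) z := fun z => by
    by_cases h : dist y z < ρ
    · rw [Set.indicator_of_mem (by exact h), Set.indicator_of_mem (by
        rw [Metric.mem_ball, dist_comm]; exact h)]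
    · rw [Set.indicator_of_notMem (by exact h), Set.indicator_of_notMem (by
        rw [Metric.mem_ball, dist_comm]; exact h)]
  simp_rw [h2]
  rw [lintegral_indicator_const Metric.isOpen_ball.measurableSet, Measure.addHaar_ball_center,
    mul_comm]

/-- A function whose `L²` norms over all balls of radius `ρ` are bounded integrates against the
decaying weight at scale `ρ`. -/
theorem exists_lintegral_mul_decayWeight_le :
    ∃ C : ℝ, 1 ≤ C ∧ ∀ (F : R3 → ℝ≥0∞), AEMeasurable F volume → ∀ (ρ : ℝ), 0 < ρ → ∀ (Q : ℝ≥0∞),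
      (∀ z, ∫⁻ y in Metric.ball z ρ, F y ^ 2 ≤ Q) → ∀ x : R3,
      ∫⁻ y, F y * decayWeight ρ (y - x) ≤ ENNReal.ofReal (C * ρ ^ (3 / 2 : ℝ)) * Q ^ (1 / 2 : ℝ) := by
  let v : ℝ := (volume (Metric.ball (0 : R3) 1)).toReal
  have hv : 0 < v := ENNReal.toReal_pos (Metric.measure_ball_pos _ _ one_pos).ne'
    measure_ball_lt_top.ne
  let J : ℝ := (∫⁻ x, decayWeight 1 x).toReal
  have hJ : 0 ≤ J := ENNReal.toReal_nonneg
  refine ⟨16 * J * v ^ (-(1 / 2) : ℝ) + 1, by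
    have : 0 ≤ 16 * J * v ^ (-(1 / 2) : ℝ) := by positivity
    linarith, fun F hF ρ hρ Q hQ x => ?_⟩
  have hV : volume (Metric.ball (0 : R3) ρ) = ENNReal.ofReal (ρ ^ 3 * v) := by
    rw [Measure.addHaar_ball _ _ hρ.le, finrank_R3, ENNReal.ofReal_mul (by positivity),
      ENNReal.ofReal_toReal measure_ball_lt_top.ne]
  have hball : ∀ z : R3, ∫⁻ y in Metric.ball z ρ, F y ≤
      Q ^ (1 / 2 : ℝ) * ENNReal.ofReal (ρ ^ 3 * v) ^ (1 / 2 : ℝ) := fun z => by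
    have h := ENNReal.lintegral_mul_le_Lp_mul_Lq (volume.restrict (Metric.ball z ρ))
      Real.HolderConjugate.two_two hF.restrict (g := 1) aemeasurable_const
    simp only [mul_one, Pi.one_apply, ENNReal.one_rpow, lintegral_const, Measure.restrict_apply,
      MeasurableSet.univ, Set.univ_inter, one_mul] at h
    rw [Measure.addHaar_ball_center, hV] at h
    refine h.trans ?_
    gcongr
    exact_mod_cast hQ z
  have hVpos : 0 < ρ ^ 3 * v := by positivity
  -- Averaged over balls `B(z, ρ)`: on each the weight varies by a factor at most `16`, and
  -- Cauchy-Schwarz bounds the integral of `F`.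
  have key : ENNReal.ofReal (ρ ^ 3 * v) * ∫⁻ y, F y * decayWeight ρ (y - x) ≤
      ENNReal.ofReal (ρ ^ 3 * v) *
        (ENNReal.ofReal (16 * J * v ^ (-(1 / 2) : ℝ) * ρ ^ (3 / 2 : ℝ)) * Q ^ (1 / 2 : ℝ)) := by
    have hprod : AEMeasurable (fun y => F y * decayWeight ρ (y - x)) volume :=
      hF.mul ((measurable_decayWeight ρ).comp (measurable_sub_const x)).aemeasurable
    rw [← hV, ← lintegral_lintegral_ball hprod, hV]
    calc _ ≤ ∫⁻ z, 16 * (Q ^ (1 / 2 : ℝ) * ENNReal.ofReal (ρ ^ 3 * v) ^ (1 / 2 : ℝ)) *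
            decayWeight ρ (z - x) := by
          refine lintegral_mono fun z => ?_
          calc _ ≤ ∫⁻ y in Metric.ball z ρ, F y * (16 * decayWeight ρ (z - x)) := by
                refine setLIntegral_mono' Metric.isOpen_ball.measurableSet fun y hy => ?_
                gcongr
                refine decayWeight_le_of_dist_le hρ ?_
                rw [sub_sub_sub_cancel_right, ← dist_eq_norm, dist_comm]
                exact (Metric.mem_ball.mp hy).le
            _ = (∫⁻ y in Metric.ball z ρ, F y) * (16 * decayWeight ρ (z - x)) :=
                lintegral_mul_const' _ _ (ENNReal.mul_ne_top (by norm_num) ENNReal.ofReal_ne_top)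
            _ ≤ _ := by
                grw [hball z]
                exact le_of_eq (by ring)
      _ = 16 * (Q ^ (1 / 2 : ℝ) * ENNReal.ofReal (ρ ^ 3 * v) ^ (1 / 2 : ℝ)) *
            (ENNReal.ofReal (ρ ^ 3) * ENNReal.ofReal J) := by
          have hwm : Measurable fun z => decayWeight ρ (z - x) :=
            (measurable_decayWeight ρ).comp (measurable_sub_const x)
          rw [lintegral_const_mul _ hwm,
            lintegral_decayWeight hρ, ENNReal.ofReal_toReal lintegral_decayWeight_ne_top]
      _ = ENNReal.ofReal (16 * (ρ ^ 3 * v) ^ (1 / 2 : ℝ) * (ρ ^ 3 * J)) * Q ^ (1 / 2 : ℝ) := by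
          rw [ENNReal.ofReal_rpow_of_nonneg hVpos.le (by norm_num),
            ENNReal.ofReal_mul (by positivity), ENNReal.ofReal_mul (by positivity),
            ENNReal.ofReal_mul (p := ρ ^ 3) (by positivity)]
          rw [show ENNReal.ofReal 16 = 16 by norm_num]
          ring
      _ = _ := by
          rw [← mul_assoc (ENNReal.ofReal _) (ENNReal.ofReal _), ← ENNReal.ofReal_mul hVpos.le]
          congr 2
          have e1 : (ρ ^ 3) ^ (1 / 2 : ℝ) = ρ ^ (3 / 2 : ℝ) := by
            rw [← Real.rpow_natCast, ← Real.rpow_mul hρ.le]; norm_num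
          have e2 : v ^ (1 / 2 : ℝ) = v * v ^ (-(1 / 2) : ℝ) := by
            rw [← Real.rpow_one_add' hv.le (by norm_num)]; norm_num
          rw [Real.mul_rpow (by positivity) hv.le, e1, e2]
          ring
  have key2 := (ENNReal.mul_le_mul_iff_right
    (ENNReal.ofReal_pos.mpr hVpos).ne' ENNReal.ofReal_ne_top).mp key
  refine key2.trans ?_
  gcongr
  linarith

/-- Extends to all Schwartz functions by approximants dominated by `v`; the right side may be
infinite. -/
theorem enorm_apply_le_lintegral {T : 𝓢'(R3, ℂ)} {f : R3 → ℂ} (hf : IsFunction T f)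
    (v : 𝓢(R3, ℂ)) : ‖T v‖ₑ ≤ ∫⁻ y, ‖f y‖ₑ * ‖v y‖ₑ := by
  obtain ⟨w, hwc, hwle, hw⟩ := exists_tendsto_hasCompactSupport v
  refine le_of_tendsto ((T.continuous.tendsto v).comp hw).enorm (Eventually.of_forall fun n => ?_)
  have h1 := hf.2 _ (hwc n)
  refine (le_of_eq (congrArg _ h1)).trans ((enorm_integral_le_lintegral_enorm _).trans ?_)
  refine lintegral_mono fun y => ?_
  rw [enorm_mul, mul_comm]
  gcongr
  exact enorm_le_iff_norm_le.mpr (hwle n y)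

/-- The kernel is a rescaling of the Fourier transform of `φ`, a Schwartz function. -/
theorem exists_enorm_fourier_lowSymbol_le {φ : R3 → ℝ} (hφ : IsLittlewoodPaleyBump φ) :
    ∃ C : ℝ, 1 ≤ C ∧ ∀ M : ℝ, 0 < M → ∀ y : R3,
      ‖𝓕 (lowSymbol φ M) y‖ₑ ≤ ENNReal.ofReal (C * M ^ 3) * decayWeight (1 / M) y := by
  have hc : HasCompactSupport (fun ξ => (φ ξ : ℂ)) :=
    hφ.hasCompactSupport.comp_left (g := fun t : ℝ => (t : ℂ)) Complex.ofReal_zero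
  have hs : ContDiff ℝ (⊤ : ℕ∞) (fun ξ => (φ ξ : ℂ)) :=
    Complex.ofRealCLM.contDiff.comp hφ.contDiff
  let K : 𝓢(R3, ℂ) := 𝓕 (hc.toSchwartzMap hs)
  let D : ℝ := 2 ^ 4 * ((Finset.Iic (4, 0)).sup
    fun m : ℕ × ℕ => SchwartzMap.seminorm ℝ m.1 m.2) K
  have hD : ∀ x, (1 + ‖x‖) ^ 4 * ‖K x‖ ≤ D := fun x => by
    have := SchwartzMap.one_add_le_sup_seminorm_apply (𝕜 := ℝ) (m := (4, 0)) (k := 4) (n := 0)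
      le_rfl le_rfl K x
    rwa [norm_iteratedFDeriv_zero] at this
  have hD0 : 0 ≤ D := le_trans (by positivity) (hD 0)
  have hπ := Real.pi_pos
  refine ⟨2 * Real.pi * D + 1, by
    have : 0 ≤ 2 * Real.pi * D := by positivity
    linarith, fun M hM y => ?_⟩
  set a := 2 * Real.pi / M with ha
  have ha0 : 0 < a := by positivity
  have hscale : 𝓕 (lowSymbol φ M) y = ((a ^ 3)⁻¹ : ℝ) • K (a⁻¹ • y) := by
    have h := Measure.integral_comp_smul (volume : Measure R3)
      (fun v : R3 => Real.fourierChar (-inner ℝ v (a⁻¹ • y)) • (φ v : ℂ)) a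
    rw [finrank_R3, abs_of_pos (by positivity)] at h
    have hK : K (a⁻¹ • y) = ∫ v : R3, Real.fourierChar (-inner ℝ v (a⁻¹ • y)) • (φ v : ℂ) := by
      simp only [K]
      rw [SchwartzMap.fourier_coe, Real.fourier_eq]
      rfl
    rw [hK, ← h, Real.fourier_eq]
    refine integral_congr_ae (Eventually.of_forall fun v => ?_)
    simp only [lowSymbol, ← ha, real_inner_smul_left, real_inner_smul_right]
    rw [inv_mul_cancel_left₀ ha0.ne']
  rw [decayWeight, ← ENNReal.ofReal_mul (by positivity), ← ofReal_norm]
  refine ENNReal.ofReal_le_ofReal ?_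
  rw [hscale, norm_smul, Real.norm_of_nonneg (by positivity)]
  have h1 : ‖K (a⁻¹ • y)‖ ≤ D * ((1 + ‖a⁻¹ • y‖) ^ 4)⁻¹ := by
    rw [← div_eq_mul_inv, le_div_iff₀ (by positivity), mul_comm]
    exact hD _
  have h2 : (1 + ‖y‖ / (1 / M)) ≤ 2 * Real.pi * (1 + ‖a⁻¹ • y‖) := by
    have hy : ‖y‖ / (1 / M) = 2 * Real.pi * ‖a⁻¹ • y‖ := by
      rw [norm_smul, Real.norm_of_nonneg (by positivity), ha]; field_simp
    rw [hy]
    linarith [Real.pi_gt_three]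
  have h3 : ((1 + ‖a⁻¹ • y‖) ^ 4)⁻¹ ≤ (2 * Real.pi) ^ 4 * ((1 + ‖y‖ / (1 / M)) ^ 4)⁻¹ := by
    rw [← div_eq_mul_inv, inv_le_comm₀ (by positivity) (by positivity), inv_div,
      div_le_iff₀ (by positivity), mul_comm, ← mul_pow]
    gcongr
  calc (a ^ 3)⁻¹ * ‖K (a⁻¹ • y)‖ ≤ (a ^ 3)⁻¹ * (D * ((2 * Real.pi) ^ 4 *
          ((1 + ‖y‖ / (1 / M)) ^ 4)⁻¹)) := by
        gcongr
        exact h1.trans (by gcongr)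
    _ = 2 * Real.pi * D * M ^ 3 * ((1 + ‖y‖ / (1 / M)) ^ 4)⁻¹ := by
        rw [ha]; field_simp
    _ ≤ _ := by gcongr; linarith

/-- Convolution theorem: both sides have the same inverse Fourier transform. -/
theorem fourier_lowSymbol_fourierInv_eq {φ : R3 → ℝ} (hφ : IsLittlewoodPaleyBump φ) {M : ℝ}
    (hM : 0 < M) (u : 𝓢(R3, ℂ)) (y : R3) :
    𝓕 (SchwartzMap.smulLeftCLM ℂ (lowSymbol φ M) (𝓕⁻ u)) y =
      ∫ x, u x * 𝓕 (lowSymbol φ M) (y - x) := by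
  let P : 𝓢(R3, ℂ) := (lowSymbol_hasCompactSupport hφ hM).toSchwartzMap (lowSymbol_contDiff hφ)
  let cv : 𝓢(R3, ℂ) := SchwartzMap.convolution (ContinuousLinearMap.mul ℂ ℂ) u (𝓕 P)
  have h1 : 𝓕⁻ cv = SchwartzMap.smulLeftCLM ℂ (lowSymbol φ M) (𝓕⁻ u) := by
    ext ξ
    rw [SchwartzMap.smulLeftCLM_apply_apply (lowSymbol_hasTemperateGrowth hφ hM)]
    have e (w : 𝓢(R3, ℂ)) : 𝓕⁻ w ξ = 𝓕 w (-ξ) := by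
      rw [SchwartzMap.fourierInv_coe, SchwartzMap.fourier_coe, Real.fourierInv_eq_fourier_neg]
    rw [e cv, SchwartzMap.fourier_convolution, SchwartzMap.pairing_apply_apply, ← e u, ← e (𝓕 P),
      FourierTransform.fourierInv_fourier_eq, ContinuousLinearMap.mul_apply', smul_eq_mul, mul_comm]
    rfl
  rw [← h1, FourierTransform.fourier_fourierInv_eq, SchwartzMap.convolution_apply]
  rfl

/-- Low frequency cutoffs are bounded through local `L²` norms. -/
theorem exists_enorm_lowpass_apply_le_local {φ : R3 → ℝ} (hφ : IsLittlewoodPaleyBump φ) :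
    ∃ C : ℝ, 1 ≤ C ∧ ∀ (T : 𝓢'(R3, ℂ)) (f : R3 → ℂ), IsFunction T f → ∀ M : ℝ, 0 < M →
      ∀ Q : ℝ≥0∞, (∀ z, ∫⁻ y in Metric.ball z (1 / M), ‖f y‖ₑ ^ 2 ≤ Q) → ∀ u : 𝓢(R3, ℂ),
      ‖TemperedDistribution.fourierMultiplierCLM ℂ (lowSymbol φ M) T u‖ₑ ≤
        (ENNReal.ofReal (C * M ^ (3 / 2 : ℝ)) * Q ^ (1 / 2 : ℝ)) * ∫⁻ x, ‖u x‖ₑ := by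
  obtain ⟨C₁, hC₁, h1⟩ := exists_enorm_fourier_lowSymbol_le hφ
  obtain ⟨C₂, hC₂, h2⟩ := exists_lintegral_mul_decayWeight_le
  refine ⟨C₁ * C₂, one_le_mul_of_one_le_of_one_le hC₁ hC₂, fun T f hf M hM Q hQ u => ?_⟩
  have hfm : AEMeasurable (fun y => ‖f y‖ₑ) volume := hf.1.aestronglyMeasurable.enorm
  rw [TemperedDistribution.fourierMultiplierCLM_apply_apply]
  refine (enorm_apply_le_lintegral hf _).trans ?_
  have hwm : Measurable fun p : R3 × R3 => decayWeight (1 / M) (p.1 - p.2) :=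
    (measurable_decayWeight _).comp (measurable_fst.sub measurable_snd)
  have hum : Measurable fun x => ‖u x‖ₑ := u.continuous.measurable.enorm
  calc _ ≤ ∫⁻ y, ∫⁻ x, ‖f y‖ₑ * (‖u x‖ₑ *
          (ENNReal.ofReal (C₁ * M ^ 3) * decayWeight (1 / M) (y - x))) := by
        refine lintegral_mono fun y => ?_
        rw [lintegral_const_mul' _ _ enorm_ne_top, fourier_lowSymbol_fourierInv_eq hφ hM]
        gcongr
        refine (enorm_integral_le_lintegral_enorm _).trans (lintegral_mono fun x => ?_)
        rw [enorm_mul]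
        gcongr
        exact h1 M hM _
    -- Integrating in `y` first leaves the weight centred at `x`, where the local bound applies
    -- uniformly.
    _ = ∫⁻ x, ∫⁻ y, ‖f y‖ₑ * (‖u x‖ₑ *
          (ENNReal.ofReal (C₁ * M ^ 3) * decayWeight (1 / M) (y - x))) := by
        refine lintegral_lintegral_swap ?_
        exact hfm.comp_fst.mul ((hum.comp measurable_snd).mul (hwm.const_mul _)).aemeasurable
    _ = ∫⁻ x, ‖u x‖ₑ * ENNReal.ofReal (C₁ * M ^ 3) *
          ∫⁻ y, ‖f y‖ₑ * decayWeight (1 / M) (y - x) := by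
        refine lintegral_congr fun x => ?_
        rw [← lintegral_const_mul' _ _ (ENNReal.mul_ne_top enorm_ne_top ENNReal.ofReal_ne_top)]
        refine lintegral_congr fun y => ?_
        ring
    _ ≤ ∫⁻ x, ‖u x‖ₑ * ENNReal.ofReal (C₁ * M ^ 3) *
          (ENNReal.ofReal (C₂ * (1 / M) ^ (3 / 2 : ℝ)) * Q ^ (1 / 2 : ℝ)) := by
        refine lintegral_mono fun x => ?_
        gcongr
        exact h2 _ hfm _ (by positivity) Q hQ x
    _ = (∫⁻ x, ‖u x‖ₑ) * (ENNReal.ofReal (C₁ * M ^ 3) *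
          (ENNReal.ofReal (C₂ * (1 / M) ^ (3 / 2 : ℝ)) * Q ^ (1 / 2 : ℝ))) := by
        simp_rw [mul_assoc]
        rw [lintegral_mul_const _ hum]
    _ = _ := by
        rw [mul_comm, ← mul_assoc, ← ENNReal.ofReal_mul (by positivity)]
        congr 3
        have : M ^ 3 * (1 / M) ^ (3 / 2 : ℝ) = M ^ (3 / 2 : ℝ) := by
          rw [one_div, Real.inv_rpow hM.le, ← Real.rpow_neg hM.le, ← Real.rpow_natCast,
            ← Real.rpow_add hM]
          norm_num
        rw [← this]; ring

/-! ### Level sets of the high-frequency part and its `L^q` norm. -/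

theorem IsFunction.sub {S T : 𝓢'(R3, ℂ)} {g h : R3 → ℂ} (hS : IsFunction S g)
    (hT : IsFunction T h) : IsFunction (S - T) (g - h) := by
  refine ⟨hS.1.sub hT.1, fun u hu => ?_⟩
  have e : (S - T) u = S u - T u := rfl
  have h1 := hS.1.integrable_smul_left_of_hasCompactSupport u.continuous hu
  have h2 := hT.1.integrable_smul_left_of_hasCompactSupport u.continuous hu
  simp only [smul_eq_mul] at h1 h2
  rw [e, hS.2 u hu, hT.2 u hu, ← integral_sub h1 h2]
  refine integral_congr_ae (Eventually.of_forall fun y => ?_)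
  simp only [Pi.sub_apply, mul_sub]

theorem projGE_apply {φ : R3 → ℝ} (hφ : IsLittlewoodPaleyBump φ) {M : ℝ} (hM : 0 < M)
    (T : 𝓢'(R3, ℂ)) (u : 𝓢(R3, ℂ)) :
    projGE φ M T u =
      T u - TemperedDistribution.fourierMultiplierCLM ℂ (lowSymbol φ M) T u := by
  have h1 : projGE φ M T u = T (𝓕 (SchwartzMap.smulLeftCLM ℂ (highSymbol φ M) (𝓕⁻ u))) := rfl
  have h2 : 𝓕 (SchwartzMap.smulLeftCLM ℂ (highSymbol φ M) (𝓕⁻ u)) =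
      u - 𝓕 (SchwartzMap.smulLeftCLM ℂ (lowSymbol φ M) (𝓕⁻ u)) := by
    rw [highSymbol_eq, SchwartzMap.smulLeftCLM_sub (Function.HasTemperateGrowth.const 1)
      (lowSymbol_hasTemperateGrowth hφ hM), sub_apply, SchwartzMap.smulLeftCLM_const]
    refine (congrArg 𝓕 (congrArg (· - _) (one_smul ℂ (𝓕⁻ u)))).trans ?_
    refine ((FourierTransform.fourierCLM ℂ 𝓢(R3, ℂ)).map_sub _ _).trans ?_
    simp
  rw [h1, h2, TemperedDistribution.fourierMultiplierCLM_apply_apply, map_sub]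

theorem setLIntegral_enorm_sq_ne_top {g : R3 → ℂ} {s : ℝ} (hs : 0 < s)
    (hW : ∫⁻ ξ, ENNReal.ofReal ((2 * Real.pi * ‖ξ‖) ^ (2 * s)) * ‖g ξ‖ₑ ^ 2 ≠ ⊤) {M : ℝ}
    (hM : 0 < M) : ∫⁻ ξ in {ξ : R3 | M ≤ 2 * Real.pi * ‖ξ‖}, ‖g ξ‖ₑ ^ 2 ≠ ⊤ := by
  have hset : MeasurableSet {ξ : R3 | M ≤ 2 * Real.pi * ‖ξ‖} :=
    measurableSet_le measurable_const (by fun_prop)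
  refine ne_top_of_le_ne_top (ENNReal.mul_ne_top (ENNReal.ofReal_ne_top
    (r := M ^ (-(2 * s)))) hW) ?_
  rw [← lintegral_const_mul' _ _ ENNReal.ofReal_ne_top]
  refine (setLIntegral_mono' hset fun ξ hξ => ?_).trans (setLIntegral_le_lintegral _ _)
  rw [← mul_assoc, ← ENNReal.ofReal_mul (by positivity)]
  refine le_mul_of_one_le_left zero_le ?_
  rw [ENNReal.one_le_ofReal, Real.rpow_neg hM.le, ← div_eq_inv_mul,
    one_le_div (by positivity)]
  exact Real.rpow_le_rpow hM.le hξ (by linarith)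

/-- The difference of the two high-frequency parts is `P_{<M} T - P_{<N} T`, bounded by duality with
`L¹`. -/
theorem ae_norm_sub_le {φ : R3 → ℝ} (hφ : IsLittlewoodPaleyBump φ) {T : 𝓢'(R3, ℂ)}
    {M N a b : ℝ} (hM : 0 < M) (hN : 0 < N) {h k : R3 → ℂ} (hh : IsFunction (projGE φ N T) h)
    (hk : IsFunction (projGE φ M T) k) (ha0 : 0 ≤ a) (hb0 : 0 ≤ b)
    (ha : ∀ u : 𝓢(R3, ℂ), ‖TemperedDistribution.fourierMultiplierCLM ℂ (lowSymbol φ N) T u‖ₑ ≤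
      ENNReal.ofReal a * ∫⁻ x, ‖u x‖ₑ)
    (hb : ∀ u : 𝓢(R3, ℂ), ‖TemperedDistribution.fourierMultiplierCLM ℂ (lowSymbol φ M) T u‖ₑ ≤
      ENNReal.ofReal b * ∫⁻ x, ‖u x‖ₑ) :
    ∀ᵐ x, ‖h x - k x‖ ≤ a + b := by
  have conv : ∀ (z : ℂ) (c : ℝ) (u : 𝓢(R3, ℂ)), 0 ≤ c →
      ‖z‖ₑ ≤ ENNReal.ofReal c * ∫⁻ x, ‖u x‖ₑ → ‖z‖ ≤ c * ∫ x, ‖u x‖ := fun z c u hc hz => by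
    rw [← ofReal_integral_norm_eq_lintegral_enorm (u.integrable (μ := volume)),
      ← ENNReal.ofReal_mul hc, ← ofReal_norm] at hz
    exact (ENNReal.ofReal_le_ofReal_iff
      (mul_nonneg hc (integral_nonneg fun _ => norm_nonneg _))).mp hz
  refine ae_norm_le_of_isFunction (hh.sub hk) fun u _ => ?_
  have e : (projGE φ N T - projGE φ M T) u = projGE φ N T u - projGE φ M T u := rfl
  rw [e, projGE_apply hφ hN, projGE_apply hφ hM, sub_sub_sub_cancel_left, add_mul, add_comm]
  exact (norm_sub_le _ _).trans (add_le_add (conv _ _ _ hb0 (hb u)) (conv _ _ _ ha0 (ha u)))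

/-- Chebyshev, since `|k| ≥ t / 2` almost everywhere on the level set. -/
theorem meas_lt_norm_le_of_ae_norm_sub_le {h k : R3 → ℂ} {t : ℝ} (ht : 0 < t)
    (hk : AEStronglyMeasurable k volume) (hhk : ∀ᵐ x, ‖h x - k x‖ ≤ t / 2) :
    volume {x | t < ‖h x‖} ≤ ENNReal.ofReal (4 / t ^ 2) * ∫⁻ x, ‖k x‖ₑ ^ 2 := by
  have hsub : volume {x | t < ‖h x‖} ≤
      volume {x | ENNReal.ofReal ((t / 2) ^ 2) ≤ ‖k x‖ₑ ^ 2} := by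
    refine measure_mono_ae ?_
    filter_upwards [hhk] with x hx hlt
    have hlt' : t < ‖h x‖ := hlt
    have : t / 2 ≤ ‖k x‖ := by
      have := norm_add_le (h x - k x) (k x)
      rw [sub_add_cancel] at this
      linarith
    change ENNReal.ofReal ((t / 2) ^ 2) ≤ ‖k x‖ₑ ^ 2
    rw [← ofReal_norm, ← ENNReal.ofReal_pow (norm_nonneg _)]
    exact ENNReal.ofReal_le_ofReal (by gcongr)
  refine hsub.trans ((meas_ge_le_lintegral_div (hk.enorm.pow_const 2)
    (ENNReal.ofReal_pos.mpr (by positivity)).ne' ENNReal.ofReal_ne_top).trans (le_of_eq ?_))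
  rw [div_eq_mul_inv, mul_comm, ← ENNReal.ofReal_inv_of_pos (by positivity)]
  congr 2
  field_simp; norm_num

/-- If the low frequency cutoffs of `T` at `M ≥ N` are bounded by `b * M ^ (3 / 2 - s)`, then the
`L^q` norm of the high frequency part is controlled by `b` and the homogeneous Sobolev norm. -/
theorem lqNorm_projGE_le {φ : R3 → ℝ} (hφ : IsLittlewoodPaleyBump φ) {T : 𝓢'(R3, ℂ)}
    {g : R3 → ℂ} (hg : IsFunction (𝓕 T) g) {s q : ℝ} (hs : 0 < s) (hs' : s < 3 / 2)
    (hq : 1 / q = 1 / 2 - s / 3)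
    (hW : ∫⁻ ξ, ENNReal.ofReal ((2 * Real.pi * ‖ξ‖) ^ (2 * s)) * ‖g ξ‖ₑ ^ 2 ≠ ⊤)
    {N : ℝ} (hN : 0 < N) {b : ℝ} (hb : 0 < b)
    (hlow : ∀ M : ℝ, N ≤ M → ∀ u : 𝓢(R3, ℂ),
      ‖TemperedDistribution.fourierMultiplierCLM ℂ (lowSymbol φ M) T u‖ₑ ≤
        ENNReal.ofReal (b * M ^ (3 / 2 - s)) * ∫⁻ x, ‖u x‖ₑ) :
    lqNorm q (projGE φ N T) ≤ (ENNReal.ofReal (6 / s * (4 * b) ^ (q - 2)) *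
      ∫⁻ ξ, ENNReal.ofReal ((2 * Real.pi * ‖ξ‖) ^ (2 * s)) * ‖g ξ‖ₑ ^ 2) ^ (1 / q) := by
  have hp : 0 < 3 / 2 - s := by linarith
  have hqeq : q = 6 / (3 - 2 * s) := by
    have h3 : (3 : ℝ) - 2 * s ≠ 0 := by linarith
    rw [← one_div_one_div q, hq, one_div, inv_eq_one_div, div_eq_div_iff
      (by linarith [show (1 : ℝ) / 2 - s / 3 = (3 - 2 * s) / 6 by ring]) h3]
    ring
  have hq2 : q - 2 = 4 * s / (3 - 2 * s) := by
    have h3 : (3 : ℝ) - 2 * s ≠ 0 := by linarith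
    rw [hqeq]; field_simp; ring
  have hq2' : 2 < q := by
    have : 0 < q - 2 := by rw [hq2]; exact div_pos (by linarith) (by linarith)
    linarith
  obtain ⟨h, hhm, hh, hhL⟩ := exists_isFunction_projGE hφ hg hN
    (setLIntegral_enorm_sq_ne_top hs hW hN)
  let κ : Measure R3 := volume.withDensity fun ξ => ‖g ξ‖ₑ ^ 2
  -- Chosen so that `t ≤ ρ ξ` says `|ω| ≥ M` for the cutoff with `4 b M^(3/2-s) = t`; then `ρ^(q-2)`
  -- is a multiple of `|ω|^(2s)`.
  let ρ : R3 → ℝ := fun ξ => 4 * b * (2 * Real.pi * ‖ξ‖) ^ (3 / 2 - s)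
  have hπ := Real.pi_pos
  have hρ0 : ∀ ξ, 0 ≤ ρ ξ := fun ξ => by positivity
  have hρm : Measurable ρ := by fun_prop
  have hmeas : ∀ t : ℝ, 0 < t →
      volume {x | t < ‖h x‖} ≤ ENNReal.ofReal (4 / t ^ 2) * κ {ξ | t ≤ ρ ξ} := by
    intro t ht
    obtain ⟨M, hM, htM, k, hkm, hkL, hhk⟩ : ∃ M : ℝ, 0 < M ∧ t ≤ 4 * b * M ^ (3 / 2 - s) ∧
        ∃ k : R3 → ℂ, AEStronglyMeasurable k volume ∧
          ∫⁻ x, ‖k x‖ₑ ^ 2 ≤ ∫⁻ ξ in {ξ : R3 | M ≤ 2 * Real.pi * ‖ξ‖}, ‖g ξ‖ₑ ^ 2 ∧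
          ∀ᵐ x, ‖h x - k x‖ ≤ t / 2 := by
      -- For small `t` the matching cutoff would be below `N`, where `hlow` says nothing; `M = N`
      -- and `k = h` suffice.
      by_cases hcase : t ≤ 4 * b * N ^ (3 / 2 - s)
      · exact ⟨N, hN, hcase, h, hhm, hhL, Eventually.of_forall fun x => by simpa using (half_pos ht).le⟩
      · rw [not_le] at hcase
        have hNt : N ^ (3 / 2 - s) < t / (4 * b) := by
          rw [lt_div_iff₀ (by positivity)]; linarith
        set M := (t / (4 * b)) ^ (1 / (3 / 2 - s)) with hMdef
        have hMp : M ^ (3 / 2 - s) = t / (4 * b) := by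
          rw [hMdef, ← Real.rpow_mul (by positivity), one_div_mul_cancel hp.ne', Real.rpow_one]
        have hM : 0 < M := by positivity
        have hNM : N ≤ M := by
          rw [← Real.rpow_le_rpow_iff hN.le hM.le hp, hMp]; exact hNt.le
        obtain ⟨k, hkm, hk, hkL⟩ := exists_isFunction_projGE hφ hg hM
          (setLIntegral_enorm_sq_ne_top hs hW hM)
        refine ⟨M, hM, ?_, k, hkm, hkL, ?_⟩
        · exact le_of_eq (by rw [hMp]; field_simp)
        · filter_upwards [ae_norm_sub_le hφ hM hN hh hk (by positivity) (by positivity)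
            (hlow N le_rfl) (hlow M hNM)] with x hx
          refine hx.trans ?_
          have e : t / 2 = b * (t / (4 * b)) + b * (t / (4 * b)) := by field_simp; norm_num
          rw [e, hMp]
          gcongr
    refine (meas_lt_norm_le_of_ae_norm_sub_le ht hkm hhk).trans ?_
    gcongr
    refine hkL.trans ?_
    rw [withDensity_apply _ (measurableSet_le measurable_const hρm)]
    refine lintegral_mono_set fun ξ hξ => ?_
    have hξ' : M ≤ 2 * Real.pi * ‖ξ‖ := hξ
    change t ≤ 4 * b * (2 * Real.pi * ‖ξ‖) ^ (3 / 2 - s)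
    exact htM.trans (by gcongr)
  have hmain := lintegral_rpow_le_of_meas_le (h := fun x => ‖h x‖) (fun x => norm_nonneg _)
    hhm.norm.aemeasurable hρ0 hρm hq2' hmeas
  have hq0 : 0 < q := by linarith
  refine (iInf₂_le h hh).trans ?_
  rw [eLpNorm_eq_lintegral_rpow_enorm_toReal (by simpa using hq0) ENNReal.ofReal_ne_top,
    ENNReal.toReal_ofReal hq0.le]
  gcongr
  have e1 : ∫⁻ x, ‖h x‖ₑ ^ q = ∫⁻ x, ENNReal.ofReal (‖h x‖ ^ q) := by
    refine lintegral_congr fun x => ?_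
    rw [← ofReal_norm, ENNReal.ofReal_rpow_of_nonneg (norm_nonneg _) hq0.le]
  have e2 : 4 * q / (q - 2) = 6 / s := by
    rw [hq2, hqeq]
    have h3 : (3 : ℝ) - 2 * s ≠ 0 := by linarith
    field_simp
  rw [e1]
  refine hmain.trans (le_of_eq ?_)
  rw [e2, ENNReal.ofReal_mul (by positivity), mul_assoc]
  congr 1
  rw [lintegral_withDensity_eq_lintegral_mul₀ (hg.1.aestronglyMeasurable.enorm.pow_const 2)
    (by fun_prop), ← lintegral_const_mul' _ _ ENNReal.ofReal_ne_top]
  refine lintegral_congr fun ξ => ?_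
  simp only [Pi.mul_apply, ρ]
  rw [Real.mul_rpow (by positivity) (by positivity), ← Real.rpow_mul (by positivity),
    ENNReal.ofReal_mul (by positivity)]
  have e3 : (3 / 2 - s) * (q - 2) = 2 * s := by
    rw [hq2]
    have h3 : (3 : ℝ) - 2 * s ≠ 0 := by linarith
    field_simp
    norm_num
  rw [e3]
  ring

/-- The power `θ = 3 / (2s)` makes the estimate linear in `b`: `θ (q-2) / q = 1` and `2θ / q = θ -
1`. -/
theorem lqNorm_projGE_rpow_le {φ : R3 → ℝ} (hφ : IsLittlewoodPaleyBump φ) {T : 𝓢'(R3, ℂ)}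
    {g : R3 → ℂ} (hg : IsFunction (𝓕 T) g) {s₀ s q : ℝ} (hs₀ : 0 < s₀) (hs : s₀ ≤ s)
    (hs' : s < 3 / 2) (hq : 1 / q = 1 / 2 - s / 3) {ε : ℝ} (hε : 0 < ε)
    (hW : (∫⁻ ξ, ENNReal.ofReal ((2 * Real.pi * ‖ξ‖) ^ (2 * s)) * ‖g ξ‖ₑ ^ 2) ^ (1 / 2 : ℝ) ≤
      ENNReal.ofReal ε)
    {N : ℝ} (hN : 0 < N) {b : ℝ} (hb : 0 < b)
    (hlow : ∀ M : ℝ, N ≤ M → ∀ u : 𝓢(R3, ℂ),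
      ‖TemperedDistribution.fourierMultiplierCLM ℂ (lowSymbol φ M) T u‖ₑ ≤
        ENNReal.ofReal (b * M ^ (3 / 2 - s)) * ∫⁻ x, ‖u x‖ₑ) :
    lqNorm q (projGE φ N T) ^ (3 / (2 * s)) ≤
      ENNReal.ofReal (4 * (6 / s₀ + 1) ^ (3 / (2 * s₀)) * b * ε ^ (3 / (2 * s) - 1)) := by
  have hs0 : 0 < s := hs₀.trans_le hs
  set W := ∫⁻ ξ, ENNReal.ofReal ((2 * Real.pi * ‖ξ‖) ^ (2 * s)) * ‖g ξ‖ₑ ^ 2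
  have hWε : W ≤ ENNReal.ofReal (ε ^ 2) := by
    have := ENNReal.rpow_le_rpow hW two_pos.le
    rw [← ENNReal.rpow_mul, ENNReal.ofReal_rpow_of_nonneg hε.le two_pos.le] at this
    norm_num at this
    exact this
  have h := lqNorm_projGE_le hφ hg hs0 hs' hq (ne_top_of_le_ne_top ENNReal.ofReal_ne_top hWε)
    hN hb hlow
  set θ := 3 / (2 * s) with hθ
  have hθ1 : 1 < θ := by rw [hθ, lt_div_iff₀ (by linarith)]; linarith
  have hθq : 1 / q * θ = (θ - 1) / 2 := by rw [hq, hθ]; field_simp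
  have hqθ : (q - 2) * ((θ - 1) / 2) = 1 := by
    have hq0 : q ≠ 0 := by
      rintro rfl
      rw [div_zero] at hq
      linarith
    have e : θ * s = 3 / 2 := by rw [hθ]; field_simp
    have e2 : s = 3 * (1 / 2 - 1 / q) := by rw [hq]; ring
    rw [← hθq]
    rw [e2] at e
    field_simp at e ⊢
    linarith
  have hθ0 : (θ - 1) / 2 ≤ 3 / (2 * s₀) := by
    have : θ ≤ 3 / (2 * s₀) := by rw [hθ]; gcongr
    linarith
  calc lqNorm q (projGE φ N T) ^ θ
      ≤ ((ENNReal.ofReal (6 / s * (4 * b) ^ (q - 2)) * ENNReal.ofReal (ε ^ 2)) ^ (1 / q)) ^ θ := by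
        gcongr
        refine h.trans ?_
        have : 0 ≤ 1 / q := by rw [hq]; linarith
        gcongr
    _ = ENNReal.ofReal ((6 / s) ^ ((θ - 1) / 2) * (4 * b) * ε ^ (θ - 1)) := by
        rw [← ENNReal.rpow_mul, hθq, ← ENNReal.ofReal_mul (by positivity),
          ENNReal.ofReal_rpow_of_nonneg (by positivity) (by linarith),
          Real.mul_rpow (by positivity) (by positivity),
          Real.mul_rpow (by positivity) (by positivity), ← Real.rpow_mul (by positivity), hqθ,
          Real.rpow_one, ← Real.rpow_natCast, ← Real.rpow_mul hε.le]
        congr 3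
        push_cast; ring
    _ ≤ _ := by
        refine ENNReal.ofReal_le_ofReal ?_
        -- The added `1` keeps the base at least `1`, so the exponent can be enlarged too, uniformly
        -- in `s ≥ s₀`.
        have h1 : (6 / s) ^ ((θ - 1) / 2) ≤ (6 / s₀ + 1) ^ (3 / (2 * s₀)) := by
          have h6 : 6 / s ≤ 6 / s₀ + 1 := by
            have : 6 / s ≤ 6 / s₀ := by gcongr
            linarith
          calc _ ≤ (6 / s₀ + 1) ^ ((θ - 1) / 2) := by
                refine Real.rpow_le_rpow (by positivity) h6 (by linarith)
            _ ≤ _ := Real.rpow_le_rpow_of_exponent_le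
                (by have : 0 < 6 / s₀ := by positivity
                    linarith) hθ0
        calc _ ≤ (6 / s₀ + 1) ^ (3 / (2 * s₀)) * (4 * b) * ε ^ (θ - 1) := by gcongr
          _ = _ := by ring

/-- The Sobolev inequality for the high frequency part of a distribution. -/
theorem exists_lqNorm_projGE_le_homSobolevNorm {φ : R3 → ℝ} (hφ : IsLittlewoodPaleyBump φ)
    {s₀ s₁ : ℝ} (hs₀ : 0 < s₀) (hs₁ : s₁ < 3 / 2) :
    ∃ C : ℝ, 1 ≤ C ∧ ∀ s q : ℝ, s₀ ≤ s → s ≤ s₁ → 1 / q = 1 / 2 - s / 3 →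
      ∀ (T : 𝓢'(R3, ℂ)) (N : ℝ), 0 < N → ∀ ε : ℝ, 0 < ε → homSobolevNorm s T < ENNReal.ofReal ε →
      lqNorm q (projGE φ N T) ^ (3 / (2 * s)) ≤ ENNReal.ofReal (C * ε ^ (3 / (2 * s))) := by
  obtain ⟨C, hC, h⟩ := exists_lintegral_lowSymbol_mul_le hφ hs₁
  have h1 : 1 ≤ (6 / s₀ + 1) ^ (3 / (2 * s₀)) :=
    Real.one_le_rpow (by have : 0 < 6 / s₀ := by positivity
                         linarith) (by positivity)
  refine ⟨4 * (6 / s₀ + 1) ^ (3 / (2 * s₀)) * C, by nlinarith,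
    fun s q hs hs' hq T N hN ε hε hH => ?_⟩
  have hs0 : 0 < s := hs₀.trans_le hs
  obtain ⟨g, hg⟩ := iInf_lt_iff.mp hH
  obtain ⟨hgf, hgε⟩ := iInf_lt_iff.mp hg
  have h2 := lqNorm_projGE_rpow_le hφ hgf hs₀ hs (hs'.trans_lt hs₁) hq hε hgε.le hN
    (b := C * ε) (by positivity) (fun M hM u => by
      have hM0 : 0 < M := hN.trans_le hM
      refine (enorm_lowpass_apply_le hφ hgf hM0 u).trans ?_
      refine mul_le_mul_left ?_ _
      refine (h s hs0 hs' M hM0 g hgf.1.aestronglyMeasurable).trans ?_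
      rw [mul_right_comm, ENNReal.ofReal_mul (q := ε) (by positivity)]
      exact mul_le_mul_right hgε.le _)
  refine h2.trans (le_of_eq ?_)
  congr 1
  rw [Real.rpow_sub_one hε.ne']
  field_simp

/-- The improved Sobolev inequality, with a local `L²` norm on the right. -/
theorem exists_lqNorm_projGE_le_local {φ : R3 → ℝ} (hφ : IsLittlewoodPaleyBump φ)
    {s₀ : ℝ} (hs₀ : 0 < s₀) :
    ∃ C : ℝ, 1 ≤ C ∧ ∀ s q : ℝ, s₀ ≤ s → s < 3 / 2 → 1 / q = 1 / 2 - s / 3 →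
      ∀ (f : R3 → ℝ) (T : 𝓢'(R3, ℂ)), IsFunction T (fun y => (f y : ℂ)) →
      ∀ N : ℝ, 0 < N → ∀ ε : ℝ, 0 < ε → homSobolevNorm s T < ENNReal.ofReal ε →
      ∀ A : ℝ, 0 < A → (∀ (x : R3) (r : ℝ), 0 < r → r ≤ 2 / N →
        (ENNReal.ofReal (1 / r ^ (2 * s)) *
          ∫⁻ y in Metric.ball x r, ENNReal.ofReal (f y ^ 2)) ^ (1 / 2 : ℝ) ≤ ENNReal.ofReal A) →
      lqNorm q (projGE φ N T) ^ (3 / (2 * s)) ≤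
        ENNReal.ofReal (C * A * ε ^ (3 / (2 * s) - 1)) := by
  obtain ⟨C, hC, h⟩ := exists_enorm_lowpass_apply_le_local hφ
  have h1 : 1 ≤ (6 / s₀ + 1) ^ (3 / (2 * s₀)) :=
    Real.one_le_rpow (by have : 0 < 6 / s₀ := by positivity
                         linarith) (by positivity)
  refine ⟨4 * (6 / s₀ + 1) ^ (3 / (2 * s₀)) * C, by nlinarith,
    fun s q hs hs' hq f T hf N hN ε hε hH A hA hloc => ?_⟩
  have hs0 : 0 < s := hs₀.trans_le hs
  obtain ⟨g, hg⟩ := iInf_lt_iff.mp hH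
  obtain ⟨hgf, hgε⟩ := iInf_lt_iff.mp hg
  have h2 := lqNorm_projGE_rpow_le hφ hgf hs₀ hs hs' hq hε hgε.le hN
    (b := C * A) (by positivity) (fun M hM u => by
      have hM0 : 0 < M := hN.trans_le hM
      have hQ : ∀ z : R3, ∫⁻ y in Metric.ball z (1 / M), ‖(f y : ℂ)‖ₑ ^ 2 ≤
          ENNReal.ofReal ((A * M ^ (-s)) ^ 2) := by
        intro z
        -- The radius is admissible because `M ≥ N`.
        have h3 := hloc z (1 / M) (by positivity) (by gcongr; norm_num)
        have h4 := ENNReal.rpow_le_rpow h3 two_pos.le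
        rw [← ENNReal.rpow_mul, ENNReal.ofReal_rpow_of_nonneg hA.le two_pos.le,
          one_div_mul_cancel two_ne_zero, ENNReal.rpow_one, Real.rpow_two] at h4
        have h5 : ∫⁻ y in Metric.ball z (1 / M), ‖(f y : ℂ)‖ₑ ^ 2 =
            ∫⁻ y in Metric.ball z (1 / M), ENNReal.ofReal (f y ^ 2) := by
          refine lintegral_congr fun y => ?_
          rw [← ofReal_norm, ← ENNReal.ofReal_pow (norm_nonneg _), Complex.norm_real,
            Real.norm_eq_abs, sq_abs]
        have h6 : (1 : ℝ) / (1 / M) ^ (2 * s) = M ^ (2 * s) := by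
          rw [one_div M, Real.inv_rpow hM0.le, one_div, inv_inv]
        rw [h6] at h4
        rw [h5]
        calc _ = ENNReal.ofReal (M ^ (-(2 * s))) * (ENNReal.ofReal (M ^ (2 * s)) *
              ∫⁻ y in Metric.ball z (1 / M), ENNReal.ofReal (f y ^ 2)) := by
              rw [← mul_assoc, ← ENNReal.ofReal_mul (by positivity), ← Real.rpow_add hM0,
                neg_add_cancel, Real.rpow_zero, ENNReal.ofReal_one, one_mul]
          _ ≤ ENNReal.ofReal (M ^ (-(2 * s))) * ENNReal.ofReal (A ^ 2) := by gcongr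
          _ = _ := by
              rw [← ENNReal.ofReal_mul (by positivity), mul_pow, ← Real.rpow_natCast (M ^ (-s)),
                ← Real.rpow_mul hM0.le, mul_comm]
              congr 3
              push_cast; ring
      refine (h T _ hf M hM0 _ hQ u).trans (le_of_eq ?_)
      rw [ENNReal.ofReal_rpow_of_nonneg (by positivity) (by norm_num), ← Real.sqrt_eq_rpow,
        Real.sqrt_sq (by positivity), ← ENNReal.ofReal_mul (by positivity)]
      congr 2
      rw [sub_eq_add_neg, Real.rpow_add hM0]
      ring)
  refine h2.trans (le_of_eq ?_)
  congr 1
  ring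

end ReverseSobolev

/-! ### Conclusion by contradiction. -/

theorem mainTheorem4 (φ : ReverseSobolev.R3 → ℝ)
    (hφ : ReverseSobolev.IsLittlewoodPaleyBump φ)
    (s₀ s₁ : ℝ) (hs₀ : 0 < s₀) (hs₁ : s₁ < 3 / 2) :
    ∃ c : ℝ, 0 < c ∧
      ∀ s q : ℝ, s₀ ≤ s → s ≤ s₁ → 1 / q = 1 / 2 - s / 3 →
      ∀ (f : ReverseSobolev.R3 → ℝ) (T : 𝓢'(ReverseSobolev.R3, ℂ)),
        ReverseSobolev.IsFunction T (fun y => (f y : ℂ)) →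
        ReverseSobolev.MemHomSobolev s T →
      ∀ (k : ℤ) (N : ℝ), N = (2 : ℝ) ^ k →
      ∃ (x : ReverseSobolev.R3) (r : ℝ), 0 < r ∧ r ≤ 2 / N ∧
        ENNReal.ofReal c *
            (ReverseSobolev.lqNorm q (ReverseSobolev.projGE φ N T) ^ ((3 / (2 * s)) ^ 2 : ℝ) *
              ReverseSobolev.homSobolevNorm s T ^ (1 - (3 / (2 * s)) ^ 2 : ℝ))
          ≤ (ENNReal.ofReal (1 / r ^ (2 * s)) *
              ∫⁻ y in Metric.ball x r, ENNReal.ofReal (f y ^ 2)) ^ (1 / 2 : ℝ) := by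
  obtain ⟨C₁, hC₁, hsob⟩ :=
    ReverseSobolev.exists_lqNorm_projGE_le_homSobolevNorm hφ hs₀ hs₁
  obtain ⟨C₂, hC₂, hloc⟩ := ReverseSobolev.exists_lqNorm_projGE_le_local hφ hs₀
  set θ₀ := 3 / (2 * s₀) with hθ₀
  have hθ₀p : 0 < θ₀ := by positivity
  have h2θ : (1 : ℝ) ≤ 2 ^ θ₀ := Real.one_le_rpow one_le_two hθ₀p.le
  have hE1 : 1 ≤ C₁ * 2 ^ θ₀ := one_le_mul_of_one_le_of_one_le hC₁ h2θ
  refine ⟨1 / (2 * (C₂ * 2 ^ θ₀ * (C₁ * 2 ^ θ₀) ^ θ₀)), by positivity, ?_⟩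
  set c := 1 / (2 * (C₂ * 2 ^ θ₀ * (C₁ * 2 ^ θ₀) ^ θ₀)) with hc
  have hc0 : 0 < c := by positivity
  intro s q hs hs' hq f T hf hT k N hNk
  have hN : 0 < N := by rw [hNk]; positivity
  have hs0 : 0 < s := hs₀.trans_le hs
  set X := ReverseSobolev.lqNorm q (ReverseSobolev.projGE φ N T)
  set H := ReverseSobolev.homSobolevNorm s T with hH
  set θ := 3 / (2 * s) with hθ
  have hθ1 : 1 < θ := by rw [hθ, lt_div_iff₀ (by linarith)]; linarith
  have hθθ₀ : θ ≤ θ₀ := by rw [hθ, hθ₀]; gcongr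
  have hθ2 : 0 < θ ^ 2 := by positivity
  have hHtop : H ≠ ⊤ := ne_of_lt hT
  by_cases hX0 : X = 0
  -- If `H = 0` as well, its negative power is `⊤`, but `0 * ⊤ = 0`.
  · refine ⟨0, 2 / N, by positivity, le_rfl, ?_⟩
    rw [hX0, ENNReal.zero_rpow_of_pos hθ2, zero_mul, mul_zero]
    exact zero_le
  have hH0 : H ≠ 0 := by
    -- Sobolev holds with every `ε > 0`; letting `ε → 0` forces `X = 0`.
    intro hH0
    refine hX0 ((ENNReal.rpow_eq_zero_iff_of_pos (zero_lt_one.trans hθ1)).mp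
      (le_antisymm ?_ zero_le))
    have hlim : Filter.Tendsto (fun ε : ℝ => ENNReal.ofReal (C₁ * ε ^ θ))
        (nhdsWithin 0 (Set.Ioi 0)) (nhds 0) := by
      have hcont : Continuous fun ε : ℝ => ENNReal.ofReal (C₁ * ε ^ θ) :=
        ENNReal.continuous_ofReal.comp
          (continuous_const.mul (Real.continuous_rpow_const (by linarith)))
      have := (hcont.tendsto 0).mono_left (nhdsWithin_le_nhds (s := Set.Ioi 0))
      simpa [Real.zero_rpow (by linarith : θ ≠ 0)] using this
    refine ge_of_tendsto hlim ?_
    filter_upwards [self_mem_nhdsWithin] with ε hε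
    refine hsob s q hs hs' hq T N hN ε hε ?_
    rw [← hH, hH0]
    exact ENNReal.ofReal_pos.mpr hε
  set η := H.toReal with hη
  have hη0 : 0 < η := ENNReal.toReal_pos hH0 hHtop
  have hHη : H = ENNReal.ofReal η := (ENNReal.ofReal_toReal hHtop).symm
  -- The norm is an infimum, so a strict upper bound is needed to extract a representative `g`; the
  -- `2` costs only a constant.
  have hHlt : H < ENNReal.ofReal (2 * η) := by
    rw [hHη]; exact (ENNReal.ofReal_lt_ofReal_iff (by positivity)).mpr (by linarith)
  have hS := hsob s q hs hs' hq T N hN (2 * η) (by positivity) hHlt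
  have hXtop : X ≠ ⊤ := by
    intro hXtop
    change X ^ θ ≤ _ at hS
    rw [hXtop, ENNReal.top_rpow_of_pos (by linarith)] at hS
    exact ENNReal.ofReal_ne_top (top_le_iff.mp hS)
  set a := X.toReal with ha
  have ha0 : 0 < a := ENNReal.toReal_pos hX0 hXtop
  have hXa : X = ENNReal.ofReal a := (ENNReal.ofReal_toReal hXtop).symm
  have hXθ : X ^ θ = ENNReal.ofReal (a ^ θ) := by
    rw [hXa, ENNReal.ofReal_rpow_of_pos ha0]
  have hS' : a ^ θ ≤ C₁ * (2 * η) ^ θ := by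
    change X ^ θ ≤ _ at hS
    rw [hXθ] at hS
    exact (ENNReal.ofReal_le_ofReal_iff (by positivity)).mp hS
  by_contra! hcon
  have hR : ENNReal.ofReal c * (X ^ (θ ^ 2) * H ^ (1 - θ ^ 2)) =
      ENNReal.ofReal (c * (a ^ (θ ^ 2) * η ^ (1 - θ ^ 2))) := by
    rw [hXa, hHη, ENNReal.ofReal_rpow_of_pos ha0, ENNReal.ofReal_rpow_of_pos hη0,
      ← ENNReal.ofReal_mul (by positivity), ← ENNReal.ofReal_mul (by positivity)]
  have hL := hloc s q hs (hs'.trans_lt hs₁) hq f T hf N hN (2 * η) (by positivity) hHlt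
    (c * (a ^ (θ ^ 2) * η ^ (1 - θ ^ 2))) (by positivity)
    (fun x r hr hrN => by rw [← hR]; exact (hcon x r hr hrN).le)
  change X ^ θ ≤ _ at hL
  rw [hXθ] at hL
  have hL' := (ENNReal.ofReal_le_ofReal_iff (by positivity)).mp hL
  have hratio : (a / η) ^ θ ≤ C₁ * 2 ^ θ₀ := by
    rw [Real.div_rpow ha0.le hη0.le, div_le_iff₀ (by positivity)]
    refine hS'.trans ?_
    rw [Real.mul_rpow two_pos.le hη0.le, ← mul_assoc]
    gcongr
    exact one_le_two
  -- This bounds the surplus of `(a / η)^(θ²)` over `(a / η)^θ`.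
  have hpow : ((a / η) ^ θ) ^ (θ - 1) ≤ (C₁ * 2 ^ θ₀) ^ θ₀ :=
    (Real.rpow_le_rpow (by positivity) hratio (by linarith)).trans
      (Real.rpow_le_rpow_of_exponent_le hE1 (by linarith))
  have hsplit : a ^ (θ ^ 2) * η ^ (1 - θ ^ 2) * η ^ (θ - 1) =
      a ^ θ * ((a / η) ^ θ) ^ (θ - 1) := by
    rw [← Real.rpow_mul (by positivity), Real.div_rpow ha0.le hη0.le, mul_assoc,
      ← Real.rpow_add hη0, div_eq_mul_inv, ← Real.rpow_neg hη0.le, ← mul_assoc,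
      ← Real.rpow_add ha0]
    congr 2 <;> ring
  have h2pow : (2 : ℝ) ^ (θ - 1) ≤ 2 ^ θ₀ :=
    Real.rpow_le_rpow_of_exponent_le one_le_two (by linarith)
  -- The constant `c` is exactly what makes the final factor `1 / 2`.
  have hfin : a ^ θ ≤ a ^ θ / 2 := by
    calc a ^ θ ≤ _ := hL'
      _ = C₂ * c * 2 ^ (θ - 1) * (a ^ (θ ^ 2) * η ^ (1 - θ ^ 2) * η ^ (θ - 1)) := by
          rw [Real.mul_rpow two_pos.le hη0.le]; ring
      _ = C₂ * c * 2 ^ (θ - 1) * (a ^ θ * ((a / η) ^ θ) ^ (θ - 1)) := by rw [hsplit]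
      _ ≤ C₂ * c * 2 ^ θ₀ * (a ^ θ * (C₁ * 2 ^ θ₀) ^ θ₀) := by gcongr
      _ = a ^ θ / 2 := by
          rw [hc]
          have : 0 < C₂ * 2 ^ θ₀ * (C₁ * 2 ^ θ₀) ^ θ₀ := by positivity
          field_simp
  have : 0 < a ^ θ := by positivity
  linarith
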